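/- **Setting.** A reservoir holds arms of two types, optimal (type 1) and inferior (type 2), with mean rewards $\mu_1>\mu_2$ and gap $\Delta:=\mu_1-\mu_2>0$. At each time $t=1,2,\dots$ one arm is played: either an arm that was played before, or a new arm queried from the reservoir. An arm queried at time $t$ is of type 1 with probability $\alpha(t)$ and of type 2 otherwise. The reservoir is exogenous: $(\alpha(t))_{t\ge 1}$ is a deterministic, non-increasing sequence of probabilities with $\alpha(1)\in(0,1)$. The $j$-th play of arm $i$ gives a $[0,1]$-valued reward $X_{i,j}$ whose mean is $\mu_1$ or $\mu_2$ according to the type of the arm; apart from this, the reward laws may differ between arms and between plays. The types of the arms, the rewards given the types, the Gaussian perturbations below and any external randomness used to break ties are all independent. **Policy ALG2 (nested UCB).** The policy proceeds in epochs. An epoch begins by playing two new arms, called 1 and 2, once each (one after the other), and by drawing a fresh standard Gaussian variable $\mathcal Z$. Inside the epoch let $N_i$ be the number of plays of arm $i$ so far, $m=\min(N_1,N_2)$ and $s=N_1+N_2$. Before each further play: if $$\Big|\mathcal Z+\sum_{j=1}^m (X_{1,j}-X_{2,j})\Big|<4\sqrt{m\log m},$$ both arms are permanently discarded and a new epoch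 begins; otherwise an arm $i\in\{1,2\}$ maximizing $$\frac1{N_i}\sum_{j=1}^{N_i}X_{i,j}+\sqrt{\frac{2\log s}{N_i}}$$ is played. Ties are broken by an arbitrary, possibly randomized, non-anticipating rule. **Regret and constants.** Let $R_n$ be the sum over $t=1,\dots,n$ of $\mu_1$ minus the reward collected at time $t$. Let $\bar\Phi(v)=\frac1{\sqrt{2\pi}}\int_v^\infty e^{-u^2/2}\,du$, $f(x)=x+4\sqrt{x\log x}$, $T_0=\big\lceil \tfrac{64}{\Delta^2}\log^2\tfrac{64}{\Delta^2}\big\rceil$ and $\beta_\Delta=\tfrac12\bar\Phi(f(T_0))$. **Theorem.** Under ALG2, $R_n$ is integrable for every $n$, and $$\limsup_{n\to\infty}\frac{\alpha(n)\,\mathbb E R_n}{\log n}\le\frac{8}{\Delta\,\beta_\Delta}.$$ Consequently, if $\alpha(n)=\omega(\log n/n)$, that is, $\frac{\log n}{n}=o(\alpha(n))$, then the regret is sub-linear: $\mathbb E R_n=o(n)$. -/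

import Mathlib

open MeasureTheory ProbabilityTheory Filter Asymptotics

namespace NestedUCB

/-! ### The constant `β_Δ` -/

/-- Right tail of the standard Gaussian distribution. -/
noncomputable def gaussianTail (v : ℝ) : ℝ :=
  1 / Real.sqrt (2 * Real.pi) * ∫ u in Set.Ioi v, Real.exp (-u ^ 2 / 2)

/-- `T₀ = ⌈(64 / Δ²) log² (64 / Δ²)⌉`. -/
noncomputable def burnIn (Δ : ℝ) : ℕ :=
  ⌈(64 / Δ ^ 2) * (Real.log (64 / Δ ^ 2)) ^ 2⌉₊

/-- `f(x) = x + 4 √(x log x)`. -/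
noncomputable def envelope (x : ℝ) : ℝ := x + 4 * Real.sqrt (x * Real.log x)

/-- `β_Δ`. -/
noncomputable def beta (Δ : ℝ) : ℝ := gaussianTail (envelope (burnIn Δ)) / 2

/-! ### The policy

An arm is labelled by the time `a ≥ 1` at which it is queried from the reservoir. Along a sample
path, `x a j` is the reward of pull number `j + 1` of the arm queried at time `a`, and `z a` is the
Gaussian perturbation of an epoch whose first arm is queried at time `a`. -/

/-- The current epoch: its arms are those queried at times `start` and `start + 1`, and they have
been pulled `n₁` and `n₂` times. The value `n₁ = 0` only occurs before the first play. -/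
structure Epoch where
  start : ℕ
  n₁ : ℕ
  n₂ : ℕ

/-- The discarding test, with `m` the minimum of the two sample counts. -/
def Discards (x : ℕ → ℕ → ℝ) (z : ℕ → ℝ) (e : Epoch) : Prop :=
  |z e.start + ∑ j ∈ Finset.range (min e.n₁ e.n₂), (x e.start j - x (e.start + 1) j)| <
    4 * Real.sqrt ((min e.n₁ e.n₂ : ℕ) * Real.log (min e.n₁ e.n₂ : ℕ))

/-- The UCB1 index of an arm with rewards `y` that was pulled `N` times, after `s` plays. -/
noncomputable def ucbIndex (y : ℕ → ℝ) (N s : ℕ) : ℝ :=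
  (∑ j ∈ Finset.range N, y j) / N + Real.sqrt (2 * Real.log s / N)

/-- The UCB1 choice within the epoch: `True` if the first arm is played. The bit `b` decides ties;
the time that enters the index is counted from the beginning of the epoch. -/
def PlaysFirst (x : ℕ → ℕ → ℝ) (e : Epoch) (b : Bool) : Prop :=
  ucbIndex (x (e.start + 1)) e.n₂ (e.n₁ + e.n₂) < ucbIndex (x e.start) e.n₁ (e.n₁ + e.n₂) ∨
    (ucbIndex (x (e.start + 1)) e.n₂ (e.n₁ + e.n₂) = ucbIndex (x e.start) e.n₁ (e.n₁ + e.n₂) ∧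
      b = true)

open Classical in
/-- The play at time `t`, given the epoch before it: returns the epoch after the play, the label of
the arm that is played, and the number of its earlier pulls. -/
noncomputable def step (x : ℕ → ℕ → ℝ) (z : ℕ → ℝ) (b : Bool) (t : ℕ) (e : Epoch) :
    Epoch × ℕ × ℕ :=
  if e.n₁ = 0 ∨ (0 < e.n₂ ∧ Discards x z e) then (⟨t, 1, 0⟩, t, 0)
  else if e.n₂ = 0 then (⟨e.start, e.n₁, 1⟩, e.start + 1, 0)
  else if PlaysFirst x e b then (⟨e.start, e.n₁ + 1, e.n₂⟩, e.start, e.n₁)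
  else (⟨e.start, e.n₁, e.n₂ + 1⟩, e.start + 1, e.n₂)

/-- A tie-breaking rule: at time `t` it may use the observations at times `1, …, t - 1` (the reward
and the perturbation of the epoch then in force) and an external random seed. -/
abbrev TieRule (S : Type*) := ℕ → (ℕ → ℝ × ℝ) → S → Bool

/-- The run of the policy: the epoch after the play at time `t`, and the observations at times
`1, …, t` (set to `0` at all other times). -/
noncomputable def run {S : Type*} (tie : TieRule S) (x : ℕ → ℕ → ℝ) (z : ℕ → ℝ) (u : S) :
    ℕ → Epoch × (ℕ → ℝ × ℝ)
  | 0 => (⟨0, 0, 0⟩, fun _ => 0)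
  | t + 1 =>
    let p := run tie x z u t
    let s := step x z (tie (t + 1) p.2 u) (t + 1) p.1
    (s.1, Function.update p.2 (t + 1) (x s.2.1 s.2.2, z s.1.start))

/-- The reward collected at time `t ≥ 1`. -/
noncomputable def collected {S : Type*} (tie : TieRule S) (x : ℕ → ℕ → ℝ) (z : ℕ → ℝ) (u : S)
    (t : ℕ) : ℝ :=
  ((run tie x z u t).2 t).1

/-! ### The reservoir and the probabilistic model -/

/-- The two types of arms. -/
inductive ArmType where
  | optimal : ArmType
  | inferior : ArmType

instance : MeasurableSpace ArmType := ⊤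

/-- Exogenous reservoir: a deterministic non-increasing sequence of probabilities `α(1), α(2), …`
with `α(1) ∈ (0, 1)`. The value `α 0` plays no role. -/
structure IsExogenous (α : ℕ → ℝ) : Prop where
  one_pos : 0 < α 1
  one_lt_one : α 1 < 1
  nonneg : ∀ t, 1 ≤ t → 0 ≤ α t
  anti : ∀ s t, 1 ≤ s → s ≤ t → α t ≤ α s

/-- The sources of randomness: the type of the arm queried at time `a`, its rewards, the
perturbation, and the seed for tie-breaking. -/
inductive Source where
  | type (a : ℕ) : Source
  | reward (a j : ℕ) (k : ArmType) : Source
  | noise (a : ℕ) : Source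
  | seed : Source

/-- `κ a` is the type of the arm queried at time `a`; `X a j k` is the reward of its pull number
`j + 1` if it has type `k`; `Z a` and `U` are the perturbations and the seed. -/
structure Env (Ω S : Type*) where
  κ : ℕ → Ω → ArmType
  X : ℕ → ℕ → ArmType → Ω → ℝ
  Z : ℕ → Ω → ℝ
  U : Ω → S

variable {Ω S : Type*} [MeasurableSpace Ω] [MeasurableSpace S]

/-- The information carried by one source of randomness. -/
@[reducible] def Env.info (E : Env Ω S) : Source → MeasurableSpace Ω
  | .type a => MeasurableSpace.comap (E.κ a) inferInstance
  | .reward a j k => MeasurableSpace.comap (E.X a j k) inferInstance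
  | .noise a => MeasurableSpace.comap (E.Z a) inferInstance
  | .seed => MeasurableSpace.comap E.U inferInstance

/-- The model with reservoir `α` and mean rewards `μ`. The laws of the rewards are arbitrary on
`[0, 1]` and may differ between arms and between pulls; only their mean is fixed by the type. -/
structure IsModel (α : ℕ → ℝ) (μ : ArmType → ℝ) (P : Measure Ω) (E : Env Ω S) : Prop where
  measurable_κ : ∀ a, Measurable (E.κ a)
  measurable_X : ∀ a j k, Measurable (E.X a j k)
  measurable_Z : ∀ a, Measurable (E.Z a)
  measurable_U : Measurable E.U
  indep : iIndep E.info P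
  prob_optimal : ∀ a, 1 ≤ a → P {ω | E.κ a ω = ArmType.optimal} = ENNReal.ofReal (α a)
  reward_mem : ∀ a j k, ∀ᵐ ω ∂P, E.X a j k ω ∈ Set.Icc (0 : ℝ) 1
  reward_mean : ∀ a j k, ∫ ω, E.X a j k ω ∂P = μ k
  noise_law : ∀ a, P.map (E.Z a) = gaussianReal 0 1

/-- The rewards along the sample path `ω`. -/
def Env.path (E : Env Ω S) (ω : Ω) (a j : ℕ) : ℝ := E.X a j (E.κ a ω) ω

/-- The cumulative regret `R_n` of the policy after `n` plays. -/
noncomputable def regret (tie : TieRule S) (μ : ArmType → ℝ) (E : Env Ω S) (n : ℕ) (ω : Ω) : ℝ :=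
  ∑ t ∈ Finset.Icc 1 n,
    (μ ArmType.optimal - collected tie (E.path ω) (fun a => E.Z a ω) (E.U ω) t)

end NestedUCB

/-! The decision to make a given pull does not depend on the reward of that pull, so the noise in
the rewards integrates to zero and `E R_n` equals `Δ` times the expected number of plays of inferior
arms (`IsModel.integral_regret`). These plays are sorted by the time `a` at which the current epoch
starts and by the types of its two arms. The start at `a` is decided by arms queried before `a`. It
is therefore independent of the two new types, and the start and the types together are independent
of the rewards and the perturbation of the epoch.

Two inferior arms: to reach length `s`, an epoch must pass the test at level about `√s` without any
drift, or else the index policy must starve one arm although the means agree. Both have probability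
`O(s⁻²)`, so the expected length is at most an absolute constant
(`PairModel.measureReal_longStay_le`, `IsModel.sum_homogeneous_le`). Two optimal arms cost nothing.

Arms of different types: the usual UCB1 argument allows about `8 log n / Δ²` inferior pulls plus a
constant per epoch (`PairModel.measureReal_misjudges_le`, `IsModel.sum_mixed_le`).

It remains to count epochs. A mixed epoch passes all its tests, hence lasts forever, with
probability at least `β_Δ` (`PairModel.beta_le_passes`): a large perturbation carries it to `T₀`,
after which the drift `mΔ` beats the threshold. At most one epoch lasts forever, so the expected
number of mixed epochs is at most `1 / β_Δ` (`IsModel.sum_mixedProb_le`). Each epoch started up to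
time `n` is mixed with probability at least `α(n) (1 - α(1))`, so `α(n)` times the expected number
of all epochs is bounded (`IsModel.sum_starts_le`).

Altogether `α(n) E R_n ≤ α(n) (8 / (Δ β_Δ)) log n + C`. The limsup bound uses `α(n) ≤ 1`; the
sub-linear bound divides by `α(n)`. -/

namespace NestedUCB

/-! ### Deterministic properties of the policy -/

section Deterministic

variable {S : Type*} (tie : TieRule S) (x : ℕ → ℕ → ℝ) (z : ℕ → ℝ) (u : S)

/-- The play at time `t + 1`: the epoch after it, the arm, and the number of its earlier pulls. -/
noncomputable def act (t : ℕ) : Epoch × ℕ × ℕ :=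
  step x z (tie (t + 1) (run tie x z u t).2 u) (t + 1) (run tie x z u t).1

/-- The epoch after the play at time `t`. -/
noncomputable def ep (t : ℕ) : Epoch := (run tie x z u t).1

theorem run_succ (t : ℕ) :
    run tie x z u (t + 1) = ((act tie x z u t).1, Function.update (run tie x z u t).2 (t + 1)
      (x (act tie x z u t).2.1 (act tie x z u t).2.2, z (act tie x z u t).1.start)) := rfl

theorem ep_succ (t : ℕ) : ep tie x z u (t + 1) = (act tie x z u t).1 := rfl

theorem ep_zero : ep tie x z u 0 = ⟨0, 0, 0⟩ := rfl

theorem collected_succ (t : ℕ) :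
    collected tie x z u (t + 1) = x (act tie x z u t).2.1 (act tie x z u t).2.2 := by
  simp [collected, run_succ]

/-- The test is passed at level `m` by the epoch with reward sequences `y₁`, `y₂` and
perturbation `w`. -/
def Passes (y₁ y₂ : ℕ → ℝ) (w : ℝ) (m : ℕ) : Prop :=
  4 * Real.sqrt (m * Real.log m) ≤ |w + ∑ j ∈ Finset.range m, (y₁ j - y₂ j)|

theorem discards_iff (e : Epoch) :
    Discards x z e ↔ ¬ Passes (x e.start) (x (e.start + 1)) (z e.start) (min e.n₁ e.n₂) := by
  rw [Passes, not_le, Discards]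

theorem step_cases (b : Bool) (t : ℕ) (e : Epoch) :
    ((e.n₁ = 0 ∨ (0 < e.n₂ ∧ Discards x z e)) ∧ step x z b t e = (⟨t, 1, 0⟩, t, 0)) ∨
    (e.n₁ ≠ 0 ∧ e.n₂ = 0 ∧ step x z b t e = (⟨e.start, e.n₁, 1⟩, e.start + 1, 0)) ∨
    (e.n₁ ≠ 0 ∧ e.n₂ ≠ 0 ∧ ¬ Discards x z e ∧
      ucbIndex (x (e.start + 1)) e.n₂ (e.n₁ + e.n₂) ≤ ucbIndex (x e.start) e.n₁ (e.n₁ + e.n₂) ∧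
      step x z b t e = (⟨e.start, e.n₁ + 1, e.n₂⟩, e.start, e.n₁)) ∨
    (e.n₁ ≠ 0 ∧ e.n₂ ≠ 0 ∧ ¬ Discards x z e ∧
      ucbIndex (x e.start) e.n₁ (e.n₁ + e.n₂) ≤ ucbIndex (x (e.start + 1)) e.n₂ (e.n₁ + e.n₂) ∧
      step x z b t e = (⟨e.start, e.n₁, e.n₂ + 1⟩, e.start + 1, e.n₂)) := by
  unfold step
  by_cases h1 : e.n₁ = 0 ∨ (0 < e.n₂ ∧ Discards x z e)
  · exact Or.inl ⟨h1, if_pos h1⟩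
  · rw [if_neg h1]
    push Not at h1
    by_cases h2 : e.n₂ = 0
    · rw [if_pos h2]
      exact Or.inr (Or.inl ⟨h1.1, h2, rfl⟩)
    · rw [if_neg h2]
      have h3 := h1.2 (Nat.pos_of_ne_zero h2)
      by_cases h4 : PlaysFirst x e b
      · rw [if_pos h4]
        refine Or.inr (Or.inr (Or.inl ⟨h1.1, h2, h3, ?_, rfl⟩))
        rcases h4 with h4 | h4
        · exact h4.le
        · exact h4.1.le
      · rw [if_neg h4]
        refine Or.inr (Or.inr (Or.inr ⟨h1.1, h2, h3, ?_, rfl⟩))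
        unfold PlaysFirst at h4
        push Not at h4
        exact h4.1

theorem act_cases (t : ℕ) (e : Epoch) (he : ep tie x z u t = e) :
    ((e.n₁ = 0 ∨ (0 < e.n₂ ∧ Discards x z e)) ∧ act tie x z u t = (⟨t + 1, 1, 0⟩, t + 1, 0)) ∨
    (e.n₁ ≠ 0 ∧ e.n₂ = 0 ∧ act tie x z u t = (⟨e.start, e.n₁, 1⟩, e.start + 1, 0)) ∨
    (e.n₁ ≠ 0 ∧ e.n₂ ≠ 0 ∧ ¬ Discards x z e ∧
      ucbIndex (x (e.start + 1)) e.n₂ (e.n₁ + e.n₂) ≤ ucbIndex (x e.start) e.n₁ (e.n₁ + e.n₂) ∧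
      act tie x z u t = (⟨e.start, e.n₁ + 1, e.n₂⟩, e.start, e.n₁)) ∨
    (e.n₁ ≠ 0 ∧ e.n₂ ≠ 0 ∧ ¬ Discards x z e ∧
      ucbIndex (x e.start) e.n₁ (e.n₁ + e.n₂) ≤ ucbIndex (x (e.start + 1)) e.n₂ (e.n₁ + e.n₂) ∧
      act tie x z u t = (⟨e.start, e.n₁, e.n₂ + 1⟩, e.start + 1, e.n₂)) := by
  subst he
  exact step_cases x z _ _ _

/-- One play is made per unit of time and the first arm is labelled by its own play time, which
gives the count identity. The last clause isolates the moment when only the first arm of the pair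
has been played. -/
theorem ep_invariant (t : ℕ) (e : Epoch) (he : ep tie x z u t = e) :
    (t = 0 ∧ e = ⟨0, 0, 0⟩) ∨
    (1 ≤ t ∧ 1 ≤ e.start ∧ 1 ≤ e.n₁ ∧ e.start + e.n₁ + e.n₂ = t + 1 ∧
      (e.n₂ = 0 → e.n₁ = 1)) := by
  induction t generalizing e with
  | zero => exact Or.inl ⟨rfl, he.symm⟩
  | succ t ih =>
    right
    rw [ep_succ] at he
    subst he
    have h := ih _ rfl
    rcases act_cases tie x z u t _ rfl with ⟨-, h'⟩ | ⟨h1, h2, h'⟩ | ⟨h1, h2, -, -, h'⟩ |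
      ⟨h1, h2, -, -, h'⟩ <;> rw [h']
    · exact ⟨by omega, by simp, by simp, by simp, by simp⟩
    all_goals
      rcases h with ⟨-, h⟩ | h
      · rw [h] at h1
        exact absurd rfl h1
      · refine ⟨by omega, h.2.1, ?_, ?_, ?_⟩ <;> simp only <;> omega

theorem ep_start_le (t : ℕ) : (ep tie x z u t).start ≤ t := by
  rcases ep_invariant tie x z u t _ rfl with ⟨h0, h⟩ | h
  · rw [h]; exact Nat.zero_le _
  · omega

theorem one_le_ep_start {t : ℕ} (ht : 1 ≤ t) : 1 ≤ (ep tie x z u t).start := by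
  rcases ep_invariant tie x z u t _ rfl with ⟨h0, h⟩ | h
  · omega
  · exact h.2.1

/-- The value `a` can become the start of an epoch only at time `a`. This replaces "the epoch of `a`
is in force at `t`" by an event decided at time `a`. -/
theorem ep_start_of_ep_start {a t : ℕ} (hat : a ≤ t) (h : (ep tie x z u t).start = a) :
    (ep tie x z u a).start = a := by
  induction t, hat using Nat.le_induction with
  | base => exact h
  | succ t hat ih =>
    apply ih
    rw [ep_succ] at h
    rcases act_cases tie x z u t _ rfl with ⟨-, h'⟩ | ⟨-, -, h'⟩ | ⟨-, -, -, -, h'⟩ |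
      ⟨-, -, -, -, h'⟩ <;> rw [h'] at h <;> simp only at h
    · omega
    all_goals exact h

/-- The pull number `j` of arm `a` has taken place, or is excluded for good, when the current
epoch is `e`. -/
def Epoch.Seen (e : Epoch) (a j : ℕ) : Prop :=
  a < e.start ∨ (a = e.start ∧ j < e.n₁) ∨ (a = e.start + 1 ∧ j < e.n₂)

theorem not_seen_act (t : ℕ) :
    ¬ (ep tie x z u t).Seen (act tie x z u t).2.1 (act tie x z u t).2.2 := by
  have h := ep_invariant tie x z u t _ rfl
  have hs := ep_start_le tie x z u t
  unfold Epoch.Seen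
  rcases act_cases tie x z u t _ rfl with ⟨h1, h'⟩ | ⟨h1, h2, h'⟩ | ⟨h1, h2, -, -, h'⟩ |
      ⟨h1, h2, -, -, h'⟩ <;> rw [h'] <;> simp only
  · rcases h with ⟨rfl, h⟩ | h
    · rw [h]; simp
    · omega
  all_goals omega

theorem seen_act (t : ℕ) :
    (ep tie x z u (t + 1)).Seen (act tie x z u t).2.1 (act tie x z u t).2.2 := by
  rw [ep_succ]
  unfold Epoch.Seen
  rcases act_cases tie x z u t _ rfl with ⟨h1, h'⟩ | ⟨h1, h2, h'⟩ | ⟨h1, h2, -, -, h'⟩ |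
      ⟨h1, h2, -, -, h'⟩ <;> rw [h'] <;> simp

theorem Epoch.Seen.succ {t a j : ℕ} (hs : (ep tie x z u t).Seen a j) :
    (ep tie x z u (t + 1)).Seen a j := by
  rw [ep_succ]
  have h := ep_invariant tie x z u t _ rfl
  unfold Epoch.Seen at hs ⊢
  rcases act_cases tie x z u t _ rfl with ⟨h1, h'⟩ | ⟨h1, h2, h'⟩ | ⟨h1, h2, -, -, h'⟩ |
      ⟨h1, h2, -, -, h'⟩ <;> rw [h'] <;> simp only
  · rcases h with ⟨rfl, h⟩ | h
    · rw [h] at hs; simp at hs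
    · omega
  all_goals omega

theorem Epoch.Seen.mono {t t' a j : ℕ} (htt : t ≤ t') (hs : (ep tie x z u t).Seen a j) :
    (ep tie x z u t').Seen a j := by
  induction t', htt using Nat.le_induction with
  | base => exact hs
  | succ t' _ ih => exact ih.succ

/-- `Seen` persists in time, fails just before a pull and holds just after it; hence no pull is made
twice. -/
theorem act_injective {t t' : ℕ} (h : (act tie x z u t).2 = (act tie x z u t').2) : t = t' := by
  rcases lt_trichotomy t t' with hlt | heq | hlt
  · exact absurd ((seen_act tie x z u t).mono tie x z u hlt)
      (by rw [h]; exact not_seen_act tie x z u t')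
  · exact heq
  · exact absurd ((seen_act tie x z u t').mono tie x z u hlt)
      (by rw [← h]; exact not_seen_act tie x z u t)

/-! ### Locality -/

variable {x z} in
theorem step_congr {x' : ℕ → ℕ → ℝ} {z' : ℕ → ℝ} (b : Bool) (t : ℕ) (e : Epoch)
    (h1 : ∀ j < e.n₁, x e.start j = x' e.start j)
    (h2 : ∀ j < e.n₂, x (e.start + 1) j = x' (e.start + 1) j)
    (hz : z e.start = z' e.start) : step x z b t e = step x' z' b t e := by
  have hd : Discards x z e ↔ Discards x' z' e := by
    unfold Discards
    rw [hz]
    have : ∑ j ∈ Finset.range (min e.n₁ e.n₂), (x e.start j - x (e.start + 1) j) =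
        ∑ j ∈ Finset.range (min e.n₁ e.n₂), (x' e.start j - x' (e.start + 1) j) := by
      refine Finset.sum_congr rfl fun j hj => ?_
      rw [Finset.mem_range, lt_min_iff] at hj
      rw [h1 j hj.1, h2 j hj.2]
    rw [this]
  have hi1 (s : ℕ) : ucbIndex (x e.start) e.n₁ s = ucbIndex (x' e.start) e.n₁ s := by
    unfold ucbIndex
    rw [Finset.sum_congr rfl fun j hj => h1 j (Finset.mem_range.1 hj)]
  have hi2 (s : ℕ) : ucbIndex (x (e.start + 1)) e.n₂ s = ucbIndex (x' (e.start + 1)) e.n₂ s := by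
    unfold ucbIndex
    rw [Finset.sum_congr rfl fun j hj => h2 j (Finset.mem_range.1 hj)]
  have hp : PlaysFirst x e b ↔ PlaysFirst x' e b := by
    unfold PlaysFirst
    rw [hi1, hi2]
  unfold step
  classical
  exact if_congr (by rw [hd]) rfl (if_congr Iff.rfl rfl (if_congr hp rfl rfl))

theorem act_label_le (t : ℕ) : (act tie x z u t).2.1 ≤ t + 1 := by
  have hs := ep_start_le tie x z u t
  rcases act_cases tie x z u t _ rfl with ⟨h1, h'⟩ | ⟨h1, h2, h'⟩ | ⟨h1, h2, -, -, h'⟩ |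
      ⟨h1, h2, -, -, h'⟩ <;> rw [h'] <;> simp only <;> omega

theorem act_pull_le (t : ℕ) : (act tie x z u t).2.2 ≤ t := by
  have h := ep_invariant tie x z u t _ rfl
  rcases act_cases tie x z u t _ rfl with ⟨h1, h'⟩ | ⟨h1, h2, h'⟩ | ⟨h1, h2, -, -, h'⟩ |
      ⟨h1, h2, -, -, h'⟩ <;> rw [h'] <;> simp only
  · omega
  · omega
  all_goals
    rcases h with ⟨rfl, h⟩ | h
    · rw [h]
    · omega

variable {x z} in
theorem act_congr_of_lt {x' : ℕ → ℕ → ℝ} {z' : ℕ → ℝ} {a : ℕ} (hx : ∀ b < a, x b = x' b)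
    (hz : ∀ b < a, z b = z' b) {t : ℕ} (ht : t < a)
    (hr : run tie x z u t = run tie x' z' u t) : act tie x z u t = act tie x' z' u t := by
  have h := ep_invariant tie x z u t _ rfl
  have hs := ep_start_le tie x z u t
  unfold act
  rw [← hr]
  refine step_congr _ _ _ (fun j _ => ?_) (fun j hj => ?_) ?_
  · exact congrFun (hx _ (lt_of_le_of_lt hs ht)) _
  -- The label of the second arm can equal `a`, but its rewards are read only after its first pull,
  -- and then it was queried at time `t` or earlier.
  · rw [hx]
    change (ep tie x z u t).start + 1 < a
    change j < (ep tie x z u t).n₂ at hj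
    rcases h with ⟨rfl, h⟩ | h
    · rw [h] at hj; simp at hj
    · omega
  · exact hz _ (lt_of_le_of_lt hs ht)

variable {x z} in
theorem run_congr_of_lt {x' : ℕ → ℕ → ℝ} {z' : ℕ → ℝ} {a : ℕ} (hx : ∀ b < a, x b = x' b)
    (hz : ∀ b < a, z b = z' b) {t : ℕ} (ht : t < a) :
    run tie x z u t = run tie x' z' u t := by
  induction t with
  | zero => rfl
  | succ t ih =>
    have hr := ih (by omega)
    have ha := act_congr_of_lt tie u hx hz (show t < a by omega) hr
    have hl := act_label_le tie x z u t
    have hs := ep_start_le tie x z u (t + 1)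
    rw [ep_succ] at hs
    rw [run_succ, run_succ, ← ha, ← hr, hx _ (lt_of_le_of_lt hl ht), hz _ (lt_of_le_of_lt hs ht)]

variable {x z} in
/-- The epoch in force after the play at time `a` is determined by the arms queried before. -/
theorem ep_congr_of_lt {x' : ℕ → ℕ → ℝ} {z' : ℕ → ℝ} {a : ℕ} (hx : ∀ b < a, x b = x' b)
    (hz : ∀ b < a, z b = z' b) : ep tie x z u a = ep tie x' z' u a := by
  cases a with
  | zero => rfl
  | succ t =>
    rw [ep_succ, ep_succ, act_congr_of_lt tie u hx hz (Nat.lt_succ_self t)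
      (run_congr_of_lt tie u hx hz (Nat.lt_succ_self t))]

variable {x} in
theorem act_congr_of_not_seen {x' : ℕ → ℕ → ℝ} {a j : ℕ}
    (hx : ∀ b i, (b, i) ≠ (a, j) → x b i = x' b i) {t : ℕ}
    (hr : run tie x z u t = run tie x' z u t) (hs : ¬ (ep tie x z u t).Seen a j) :
    act tie x z u t = act tie x' z u t := by
  unfold act
  rw [← hr]
  refine step_congr _ _ _ (fun i hi => hx _ _ ?_) (fun i hi => hx _ _ ?_) rfl
  · rintro ⟨rfl, rfl⟩
    exact hs (Or.inr (Or.inl ⟨rfl, hi⟩))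
  · rintro ⟨rfl, rfl⟩
    exact hs (Or.inr (Or.inr ⟨rfl, hi⟩))

-- Tables that differ in one entry generate the same run until that entry is read. It is then read
-- at the same time in both runs, and `Seen` persists in each of them afterwards.
variable {x} in
theorem run_congr_or_seen {x' : ℕ → ℕ → ℝ} {a j : ℕ}
    (hx : ∀ b i, (b, i) ≠ (a, j) → x b i = x' b i) (t : ℕ) :
    run tie x z u t = run tie x' z u t ∨
      ((ep tie x z u t).Seen a j ∧ (ep tie x' z u t).Seen a j) := by
  induction t with
  | zero => exact Or.inl rfl
  | succ t ih =>
    by_cases hs : (ep tie x z u t).Seen a j ∧ (ep tie x' z u t).Seen a j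
    · exact Or.inr ⟨hs.1.succ, hs.2.succ⟩
    · have hr := ih.resolve_right hs
      have hs' : ¬ (ep tie x z u t).Seen a j := fun h => hs ⟨h, by
        unfold ep at h ⊢
        rwa [← hr]⟩
      have ha := act_congr_of_not_seen tie z u hx hr hs'
      by_cases hp : (act tie x z u t).2 = (a, j)
      · right
        have h1 := seen_act tie x z u t
        have h2 := seen_act tie x' z u t
        rw [← ha] at h2
        rw [hp] at h1 h2
        exact ⟨h1, h2⟩
      · left
        rw [run_succ, run_succ, ← ha, ← hr, hx _ _ hp]

variable {x} in
/-- Whether pull number `j` of arm `a` takes place at time `t + 1` does not depend on its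
reward. -/
theorem act_eq_congr {x' : ℕ → ℕ → ℝ} {a j : ℕ}
    (hx : ∀ b i, (b, i) ≠ (a, j) → x b i = x' b i) (t : ℕ) (h : (act tie x z u t).2 = (a, j)) :
    (act tie x' z u t).2 = (a, j) := by
  have hs := not_seen_act tie x z u t
  rw [h] at hs
  have hr := (run_congr_or_seen tie z u hx t).resolve_right fun hh => hs hh.1
  rw [← act_congr_of_not_seen tie z u hx hr hs, h]

/-! ### History of an epoch -/

/-- The smaller count grows by at most one per play, and only after the test at its current value
was passed. The inequality is strict because the current level may still be untested. -/
theorem passes_of_lt_min (t : ℕ) (e : Epoch) (he : ep tie x z u t = e) (m : ℕ) (hm : 1 ≤ m)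
    (hlt : m < min e.n₁ e.n₂) : Passes (x e.start) (x (e.start + 1)) (z e.start) m := by
  induction t generalizing e with
  | zero => subst he; simp [ep_zero] at hlt
  | succ t ih =>
    rw [ep_succ] at he
    subst he
    have ih := ih _ rfl
    rcases act_cases tie x z u t _ rfl with ⟨h1, h'⟩ | ⟨h1, h2, h'⟩ | ⟨h1, h2, h3, -, h'⟩ |
      ⟨h1, h2, h3, -, h'⟩ <;> rw [h'] at hlt ⊢ <;> simp only at hlt ⊢
    · omega
    · omega
    all_goals
      rw [discards_iff, not_not] at h3
      rcases (show m ≤ min (ep tie x z u t).n₁ (ep tie x z u t).n₂ by omega).lt_or_eq with h | h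
      · exact ih h
      · rw [h]; exact h3

/-- Look back at the latest pull of the first arm. Since it was not the opening pull, it was chosen
by the index, at counts `n₁ - 1` and some `k`; the other count has not decreased since. -/
theorem ucbIndex_le_of_two_le_fst (t : ℕ) (e : Epoch) (he : ep tie x z u t = e)
    (hn : 2 ≤ e.n₁) : ∃ k, 1 ≤ k ∧ k ≤ e.n₂ ∧
      ucbIndex (x (e.start + 1)) k (e.n₁ - 1 + k) ≤
        ucbIndex (x e.start) (e.n₁ - 1) (e.n₁ - 1 + k) := by
  induction t generalizing e with
  | zero => subst he; simp [ep_zero] at hn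
  | succ t ih =>
    rw [ep_succ] at he
    subst he
    have ih := ih _ rfl
    rcases act_cases tie x z u t _ rfl with ⟨h1, h'⟩ | ⟨h1, h2, h'⟩ | ⟨h1, h2, h3, h4, h'⟩ |
      ⟨h1, h2, h3, h4, h'⟩ <;> rw [h'] at hn ⊢ <;> simp only at hn ⊢
    · omega
    · obtain ⟨k, hk, hk', h⟩ := ih hn
      exact ⟨k, hk, by omega, h⟩
    · exact ⟨_, Nat.one_le_iff_ne_zero.2 h2, le_rfl, h4⟩
    · obtain ⟨k, hk, hk', h⟩ := ih hn
      exact ⟨k, hk, by omega, h⟩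

theorem ucbIndex_le_of_two_le_snd (t : ℕ) (e : Epoch) (he : ep tie x z u t = e)
    (hn : 2 ≤ e.n₂) : ∃ k, 1 ≤ k ∧ k ≤ e.n₁ ∧
      ucbIndex (x e.start) k (e.n₂ - 1 + k) ≤
        ucbIndex (x (e.start + 1)) (e.n₂ - 1) (e.n₂ - 1 + k) := by
  induction t generalizing e with
  | zero => subst he; simp [ep_zero] at hn
  | succ t ih =>
    rw [ep_succ] at he
    subst he
    have ih := ih _ rfl
    rcases act_cases tie x z u t _ rfl with ⟨h1, h'⟩ | ⟨h1, h2, h'⟩ | ⟨h1, h2, h3, h4, h'⟩ |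
      ⟨h1, h2, h3, h4, h'⟩ <;> rw [h'] at hn ⊢ <;> simp only at hn ⊢
    · omega
    · omega
    · obtain ⟨k, hk, hk', h⟩ := ih hn
      exact ⟨k, hk, by omega, h⟩
    · refine ⟨_, Nat.one_le_iff_ne_zero.2 h1, le_rfl, ?_⟩
      rw [Nat.add_sub_cancel, add_comm]
      exact h4

theorem ep_start_eq_of_passes {a : ℕ} (ha : 1 ≤ a) (h : (ep tie x z u a).start = a)
    (hp : ∀ m, 1 ≤ m → Passes (x a) (x (a + 1)) (z a) m) {t : ℕ} (ht : a ≤ t) :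
    (ep tie x z u t).start = a := by
  induction t, ht using Nat.le_induction with
  | base => exact h
  | succ t ht ih =>
    rw [ep_succ]
    have hi := ep_invariant tie x z u t _ rfl
    rcases act_cases tie x z u t _ rfl with ⟨h1, h'⟩ | ⟨h1, h2, h'⟩ | ⟨h1, h2, h3, h4, h'⟩ |
      ⟨h1, h2, h3, h4, h'⟩ <;> rw [h'] <;> simp only
    · rcases hi with ⟨rfl, -⟩ | hi
      · omega
      · rcases h1 with h1 | ⟨h1, h2⟩
        · omega
        · rw [discards_iff, ih] at h2
          exact absurd (hp _ (by omega)) h2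
    all_goals exact ih

end Deterministic

/-! ### Measurability of the run -/

section Measurability

instance : MeasurableSpace Epoch := ⊤

instance : DiscreteMeasurableSpace Epoch := ⟨fun _ => trivial⟩

instance : DiscreteMeasurableSpace ArmType := ⟨fun _ => trivial⟩

instance : Countable Epoch := by
  have h : Function.Injective (fun e : Epoch => (e.start, e.n₁, e.n₂)) := by
    rintro ⟨a, b, c⟩ ⟨a', b', c'⟩ h
    simp only [Prod.mk.injEq] at h
    obtain ⟨rfl, rfl, rfl⟩ := h
    rfl
  exact h.countable

variable {S : Type*} [MeasurableSpace S]

/-- The data that determine a run: rewards, perturbations and seed. -/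
abbrev Data (S : Type*) := (ℕ → ℕ → ℝ) × (ℕ → ℝ) × S

theorem measurable_ucbIndex {Ω : Type*} [MeasurableSpace Ω] {y : Ω → ℕ → ℝ}
    (hy : ∀ j, Measurable fun ω => y ω j) (N s : ℕ) :
    Measurable fun ω => ucbIndex (y ω) N s := by
  unfold ucbIndex
  exact ((Finset.measurable_sum _ fun j _ => hy j).div_const _).add_const _

theorem measurableSet_passes {Ω : Type*} [MeasurableSpace Ω] {y₁ y₂ : Ω → ℕ → ℝ} {w : Ω → ℝ}
    (h₁ : ∀ j, Measurable fun ω => y₁ ω j) (h₂ : ∀ j, Measurable fun ω => y₂ ω j)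
    (hw : Measurable w) (m : ℕ) : MeasurableSet {ω | Passes (y₁ ω) (y₂ ω) (w ω) m} := by
  unfold Passes
  exact measurableSet_le measurable_const
    (hw.add (Finset.measurable_sum _ fun j _ => (h₁ j).sub (h₂ j))).abs

theorem measurable_step (t : ℕ) :
    Measurable fun p : ((ℕ → ℕ → ℝ) × (ℕ → ℝ)) × (Bool × Epoch) =>
      step p.1.1 p.1.2 p.2.1 t p.2.2 := by
  -- There are countably many epochs and tie bits, so both may be fixed.
  refine measurable_from_prod_countable_left fun ⟨b, e⟩ => ?_
  have hx (a j : ℕ) : Measurable fun p : (ℕ → ℕ → ℝ) × (ℕ → ℝ) => p.1 a j := by fun_prop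
  have hz (a : ℕ) : Measurable fun p : (ℕ → ℕ → ℝ) × (ℕ → ℝ) => p.2 a := by fun_prop
  have hd : MeasurableSet {p : (ℕ → ℕ → ℝ) × (ℕ → ℝ) | Discards p.1 p.2 e} := by
    simp_rw [discards_iff]
    exact (measurableSet_passes (hx _) (hx _) (hz _) _).compl
  have hp : MeasurableSet {p : (ℕ → ℕ → ℝ) × (ℕ → ℝ) | PlaysFirst p.1 e b} := by
    unfold PlaysFirst
    exact (measurableSet_lt (measurable_ucbIndex (hx _) _ _) (measurable_ucbIndex (hx _) _ _)).union
      ((measurableSet_eq_fun (measurable_ucbIndex (hx _) _ _)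
        (measurable_ucbIndex (hx _) _ _)).inter (MeasurableSet.const _))
  have hc : MeasurableSet {p : (ℕ → ℕ → ℝ) × (ℕ → ℝ) |
      e.n₁ = 0 ∨ (0 < e.n₂ ∧ Discards p.1 p.2 e)} :=
    (MeasurableSet.const (e.n₁ = 0)).union ((MeasurableSet.const (0 < e.n₂)).inter hd)
  change Measurable fun p : (ℕ → ℕ → ℝ) × (ℕ → ℝ) => step p.1 p.2 b t e
  unfold step
  refine Measurable.ite hc measurable_const (Measurable.ite (MeasurableSet.const _)
    measurable_const (Measurable.ite hp measurable_const measurable_const))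

variable {tie : TieRule S}

theorem measurable_act_of_run
    (htie : ∀ t, Measurable (fun p : (ℕ → ℝ × ℝ) × S => tie t p.1 p.2))
    {t : ℕ}
    (h : Measurable fun p : Data S => run tie p.1 p.2.1 p.2.2 t) :
    Measurable fun p : Data S => act tie p.1 p.2.1 p.2.2 t := by
  have hb : Measurable fun p : Data S => tie (t + 1) (run tie p.1 p.2.1 p.2.2 t).2 p.2.2 :=
    (htie (t + 1)).comp (h.snd.prodMk measurable_snd.snd)
  exact (measurable_step (t + 1)).comp
    ((measurable_fst.prodMk measurable_snd.fst).prodMk (hb.prodMk h.fst))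

theorem measurable_run
    (htie : ∀ t, Measurable (fun p : (ℕ → ℝ × ℝ) × S => tie t p.1 p.2))
    (t : ℕ) : Measurable fun p : Data S => run tie p.1 p.2.1 p.2.2 t := by
  induction t with
  | zero => exact measurable_const
  | succ t ih =>
    have ha := measurable_act_of_run htie ih
    simp_rw [run_succ]
    refine ha.fst.prodMk (measurable_pi_lambda _ fun i => ?_)
    have hx : Measurable fun q : (ℕ → ℕ → ℝ) × (ℕ × ℕ) => q.1 q.2.1 q.2.2 :=
      measurable_from_prod_countable_left fun q =>
        (measurable_pi_apply q.2).comp (measurable_pi_apply q.1)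
    have hz : Measurable fun q : (ℕ → ℝ) × ℕ => q.1 q.2 :=
      measurable_from_prod_countable_left fun q => measurable_pi_apply q
    have hs : Measurable fun p : Data S => (act tie p.1 p.2.1 p.2.2 t).1.start :=
      (measurable_from_top (f := Epoch.start)).comp ha.fst
    by_cases hi : i = t + 1
    · subst hi
      simp only [Function.update_self]
      exact (hx.comp (measurable_fst.prodMk ha.snd)).prodMk
        (hz.comp (measurable_snd.fst.prodMk hs))
    · simp only [Function.update_of_ne hi]
      exact (measurable_pi_apply i).comp ih.snd

theorem measurable_act
    (htie : ∀ t, Measurable (fun p : (ℕ → ℝ × ℝ) × S => tie t p.1 p.2))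
    (t : ℕ) : Measurable fun p : Data S => act tie p.1 p.2.1 p.2.2 t :=
  measurable_act_of_run htie (measurable_run htie t)

theorem measurable_ep
    (htie : ∀ t, Measurable (fun p : (ℕ → ℝ × ℝ) × S => tie t p.1 p.2))
    (t : ℕ) : Measurable fun p : Data S => ep tie p.1 p.2.1 p.2.2 t :=
  (measurable_run htie t).fst

end Measurability

/-! ### Concentration for a pair of arms -/

section Pair

variable {Ω : Type*} [MeasurableSpace Ω]

/-- The rewards `Y (some (b, j))` of two arms with means `ν true` and `ν false`, and a Gaussian
perturbation `Y none`, all independent. -/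
structure PairModel (P : Measure Ω) (Y : Option (Bool × ℕ) → Ω → ℝ) (ν : Bool → ℝ) : Prop where
  measurable : ∀ i, Measurable (Y i)
  indep : iIndepFun Y P
  mem : ∀ i, ∀ᵐ ω ∂P, Y (some i) ω ∈ Set.Icc (0 : ℝ) 1
  mean : ∀ b j, ∫ ω, Y (some (b, j)) ω ∂P = ν b
  law : P.map (Y none) = gaussianReal 0 1

/-- The mean of the `i`-th variable of a pair model. -/
def pairMean (ν : Bool → ℝ) : Option (Bool × ℕ) → ℝ := fun i => i.elim 0 fun p => ν p.1

/-- The variance proxy of the `i`-th variable of a pair model. -/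
noncomputable def pairProxy : Option (Bool × ℕ) → NNReal := fun i => i.elim 1 fun _ => 1 / 4

variable {P : Measure Ω} {Y : Option (Bool × ℕ) → Ω → ℝ}
  {ν : Bool → ℝ}

theorem PairModel.swap (h : PairModel P Y ν) :
    PairModel P (fun i => i.elim (Y none) fun p => Y (some (!p.1, p.2))) (fun b => ν (!b)) where
  measurable i := by cases i <;> exact h.measurable _
  indep := by
    let g : Option (Bool × ℕ) → Option (Bool × ℕ) := fun i => i.elim none fun p => some (!p.1, p.2)
    have hg : Function.Injective g := by
      rintro (_ | ⟨b, j⟩) (_ | ⟨b', j'⟩) hh <;> simp_all [g]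
    convert! h.indep.precomp hg using 2 with i
    cases i <;> rfl
  mem i := h.mem _
  mean b j := h.mean _ _
  law := h.law

/-- Combined with `PairModel.swap` this changes the sign of the test statistic, which turns
one-sided estimates into estimates for its absolute value. -/
theorem PairModel.neg_noise (h : PairModel P Y ν) :
    PairModel P (fun i => i.elim (fun ω => -Y none ω) fun p => Y (some p)) ν where
  measurable i := by
    cases i
    · exact (h.measurable none).neg
    · exact h.measurable _
  indep := by
    let g : ∀ _ : Option (Bool × ℕ), ℝ → ℝ := fun i => i.elim (fun y => -y) fun _ y => y
    have hg (i : Option (Bool × ℕ)) : Measurable (g i) := by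
      cases i
      · exact measurable_neg
      · exact measurable_id
    convert! h.indep.comp g hg using 2 with i
    cases i <;> rfl
  mem i := h.mem _
  mean b j := h.mean _ _
  law := by
    have := Measure.map_map (μ := P) (g := fun y : ℝ => -y) measurable_neg (h.measurable none)
    rw [h.law, gaussianReal_map_neg, neg_zero] at this
    exact this.symm

variable [IsProbabilityMeasure P]

/-- The standard Gaussian has proxy exactly `1`; Hoeffding's lemma on an interval of length `1`
gives `(1 / 2)² = 1 / 4`. -/
theorem PairModel.hasSubgaussianMGF (h : PairModel P Y ν) (i : Option (Bool × ℕ)) :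
    HasSubgaussianMGF (fun ω => Y i ω - pairMean ν i) (pairProxy i) P := by
  cases i with
  | none =>
    refine ⟨fun t => ?_, fun t => ?_⟩
    · have := (integrable_exp_mul_gaussianReal (μ := 0) (v := 1) t)
      rw [← h.law, integrable_map_measure (by fun_prop) (h.measurable none).aemeasurable] at this
      simpa [pairMean, Function.comp_def] using this
    · have := mgf_gaussianReal h.law t
      simp only [pairMean, Option.elim_none, sub_zero, pairProxy]
      rw [this]
      simp
  | some p =>
    have := hasSubgaussianMGF_of_mem_Icc (h.measurable (some p)).aemeasurable (h.mem p)
    rw [h.mean p.1 p.2] at this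
    convert! this using 1
    simp only [pairProxy, Option.elim_some, sub_zero, nnnorm_one]
    norm_num

/-- **Hoeffding's inequality** for a signed sum of the variables of a pair model. -/
theorem PairModel.measureReal_sum_ge_le (h : PairModel P Y ν) (σ : Option (Bool × ℕ) → Bool)
    (s : Finset (Option (Bool × ℕ))) {r : ℝ} (hr : 0 ≤ r) :
    P.real {ω | r ≤ ∑ i ∈ s, bif σ i then Y i ω - pairMean ν i else pairMean ν i - Y i ω} ≤
      Real.exp (-r ^ 2 / (2 * ∑ i ∈ s, (pairProxy i : ℝ))) := by
  let g : ∀ _ : Option (Bool × ℕ), ℝ → ℝ := fun i y =>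
    bif σ i then y - pairMean ν i else pairMean ν i - y
  have hg (i : Option (Bool × ℕ)) : Measurable (g i) := by
    simp only [g]
    cases σ i <;> simp only [cond_true, cond_false] <;> fun_prop
  have := HasSubgaussianMGF.measure_sum_ge_le_of_iIndepFun (h.indep.comp g hg) (c := pairProxy)
    (s := s) (fun i _ => ?_) hr
  · simpa [g, Function.comp_def] using this
  · have h1 := h.hasSubgaussianMGF i
    simp only [g, Function.comp_def]
    cases σ i
    · have h2 := h1.neg
      simp only [cond_false]
      convert! h2 using 1
      ext ω
      simp
    · simpa using h1

theorem PairModel.measureReal_upper_le (h : PairModel P Y ν) (b : Bool) (N : ℕ) {r : ℝ}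
    (hr : 0 ≤ r) :
    P.real {ω | r ≤ ∑ j ∈ Finset.range N, (Y (some (b, j)) ω - ν b)} ≤
      Real.exp (-(2 * r ^ 2 / N)) := by
  have := h.measureReal_sum_ge_le (fun _ => true)
    ((({b} : Finset Bool) ×ˢ Finset.range N).map Function.Embedding.some) hr
  simp only [Finset.sum_map, Finset.sum_product, Finset.sum_singleton,
    Function.Embedding.some_apply, pairMean, pairProxy, cond_true, Option.elim_some,
    Finset.sum_const, Finset.card_product, Finset.card_singleton, Finset.card_range,
    one_mul] at this
  refine this.trans (le_of_eq ?_)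
  congr 1
  push_cast
  rw [nsmul_eq_mul, neg_div]
  congr 1
  rw [show 2 * ((N : ℝ) * (1 / 4)) = N / 2 by ring, div_div_eq_mul_div, mul_comm]

theorem PairModel.measureReal_lower_le (h : PairModel P Y ν) (b : Bool) (N : ℕ) {r : ℝ}
    (hr : 0 ≤ r) :
    P.real {ω | r ≤ ∑ j ∈ Finset.range N, (ν b - Y (some (b, j)) ω)} ≤
      Real.exp (-(2 * r ^ 2 / N)) := by
  have := h.measureReal_sum_ge_le (fun _ => false)
    ((({b} : Finset Bool) ×ˢ Finset.range N).map Function.Embedding.some) hr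
  simp only [Finset.sum_map, Finset.sum_product, Finset.sum_singleton,
    Function.Embedding.some_apply, pairMean, pairProxy, cond_false, Option.elim_some,
    Finset.sum_const, Finset.card_product, Finset.card_singleton, Finset.card_range,
    one_mul] at this
  refine this.trans (le_of_eq ?_)
  congr 1
  push_cast
  rw [nsmul_eq_mul, neg_div]
  congr 1
  rw [show 2 * ((N : ℝ) * (1 / 4)) = N / 2 by ring, div_div_eq_mul_div, mul_comm]

theorem PairModel.measureReal_diff_le (h : PairModel P Y ν) (m : ℕ) {r : ℝ} (hr : 0 ≤ r) :
    P.real {ω | r ≤ m * (ν true - ν false) -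
      ∑ j ∈ Finset.range m, (Y (some (true, j)) ω - Y (some (false, j)) ω)} ≤
      Real.exp (-(r ^ 2 / m)) := by
  have := h.measureReal_sum_ge_le (fun i => i.elim false fun p => !p.1)
    (((Finset.univ : Finset Bool) ×ˢ Finset.range m).map Function.Embedding.some) hr
  simp only [Finset.sum_map, Finset.sum_product, Fintype.sum_bool, Function.Embedding.some_apply,
    pairMean, pairProxy, Option.elim_some, Finset.sum_const, Finset.card_product,
    Finset.card_univ, Fintype.card_bool, Finset.card_range, Bool.not_true, Bool.not_false, cond_true,
    cond_false] at this
  have hset : {ω | r ≤ m * (ν true - ν false) -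
      ∑ j ∈ Finset.range m, (Y (some (true, j)) ω - Y (some (false, j)) ω)} =
      {ω | r ≤ ∑ j ∈ Finset.range m, (ν true - Y (some (true, j)) ω) +
        ∑ j ∈ Finset.range m, (Y (some (false, j)) ω - ν false)} := by
    ext ω
    simp only [Set.mem_ofPred_eq, Finset.sum_sub_distrib, Finset.sum_const, Finset.card_range,
      nsmul_eq_mul]
    rw [show (m : ℝ) * (ν true - ν false) - (∑ j ∈ Finset.range m, Y (some (true, j)) ω -
      ∑ j ∈ Finset.range m, Y (some (false, j)) ω) =
      m * ν true - ∑ j ∈ Finset.range m, Y (some (true, j)) ω +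
        (∑ j ∈ Finset.range m, Y (some (false, j)) ω - m * ν false) by ring]
  rw [hset]
  refine this.trans (le_of_eq ?_)
  congr 1
  push_cast
  rw [nsmul_eq_mul, neg_div, Nat.cast_mul, Nat.cast_ofNat]
  congr 2
  ring

/-- Equal means cancel the drift, and the total proxy is `1 + 2m / 4 = (m + 2) / 2`. -/
theorem PairModel.measureReal_noise_add_le (h : PairModel P Y ν) (hν : ν true = ν false) (m : ℕ)
    {r : ℝ} (hr : 0 ≤ r) :
    P.real {ω | r ≤ Y none ω +
      ∑ j ∈ Finset.range m, (Y (some (true, j)) ω - Y (some (false, j)) ω)} ≤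
      Real.exp (-(r ^ 2 / (m + 2))) := by
  have := h.measureReal_sum_ge_le (fun i => i.elim true fun p => p.1)
    (Finset.insertNone ((Finset.univ : Finset Bool) ×ˢ Finset.range m)) hr
  simp only [Finset.sum_insertNone, Finset.sum_product, Fintype.sum_bool,
    pairMean, pairProxy, Option.elim_some, Option.elim_none, Finset.sum_const,
    Finset.card_product, Finset.card_univ, Fintype.card_bool, Finset.card_range,
    cond_true, cond_false, sub_zero] at this
  have hset : {ω | r ≤ Y none ω +
      ∑ j ∈ Finset.range m, (Y (some (true, j)) ω - Y (some (false, j)) ω)} =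
      {ω | r ≤ Y none ω + (∑ j ∈ Finset.range m, (Y (some (true, j)) ω - ν true) +
        ∑ j ∈ Finset.range m, (ν false - Y (some (false, j)) ω))} := by
    ext ω
    simp only [Set.mem_ofPred_eq, Finset.sum_sub_distrib, Finset.sum_const, Finset.card_range,
      nsmul_eq_mul, hν]
    rw [show (∑ j ∈ Finset.range m, Y (some (true, j)) ω -
      ∑ j ∈ Finset.range m, Y (some (false, j)) ω) =
      ∑ j ∈ Finset.range m, Y (some (true, j)) ω - m * ν false +
        (m * ν false - ∑ j ∈ Finset.range m, Y (some (false, j)) ω) by ring]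
  rw [hset]
  refine this.trans (le_of_eq ?_)
  congr 1
  push_cast
  rw [nsmul_eq_mul, neg_div, Nat.cast_mul, Nat.cast_ofNat]
  congr 2
  ring

end Pair

/-! ### An epoch with two different arms may last forever -/

theorem gaussianTail_eq (v : ℝ) : gaussianTail v = (gaussianReal 0 1).real (Set.Ioi v) := by
  rw [measureReal_def, gaussianReal_apply_eq_integral 0 one_ne_zero, ENNReal.toReal_ofReal
    (integral_nonneg fun _ => gaussianPDFReal_nonneg _ _ _)]
  simp only [gaussianTail, gaussianPDFReal_def, NNReal.coe_one, mul_one, sub_zero]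
  rw [integral_const_mul, one_div]

theorem gaussianTail_pos (v : ℝ) : 0 < gaussianTail v := by
  rw [gaussianTail_eq, measureReal_def]
  refine ENNReal.toReal_pos (fun h => ?_) (measure_ne_top _ _)
  have := gaussianReal_absolutelyContinuous' 0 (one_ne_zero (α := NNReal)) h
  simp at this

theorem beta_pos (Δ : ℝ) : 0 < beta Δ := half_pos (gaussianTail_pos _)

theorem four_lt_log {c : ℝ} (hc : 64 ≤ c) : 4 < Real.log c := by
  have h1 : Real.log 64 = 6 * Real.log 2 := by
    rw [show (64 : ℝ) = 2 ^ 6 by norm_num, Real.log_pow]; norm_num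
  have h2 := Real.log_two_gt_d9
  have h3 := Real.log_le_log (by norm_num) hc
  linarith

/-- The inequality says that from `T₀` on the threshold `4 √(m log m)` is at most half of the drift
`mΔ`. Since `log x / x` decreases beyond `e`, it is enough to check it at `c log² c` with `c = 64 /
Δ²`. -/
theorem burnIn_bounds {Δ : ℝ} (h0 : 0 < Δ) (h1 : Δ ≤ 1) :
    2 ≤ burnIn Δ ∧ ∀ m, burnIn Δ ≤ m → 64 * Real.log m ≤ Δ ^ 2 * m := by
  set c : ℝ := 64 / Δ ^ 2 with hc
  have hc64 : 64 ≤ c := by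
    rw [hc, le_div_iff₀ (by positivity)]
    nlinarith
  have hL : 4 < Real.log c := four_lt_log hc64
  have hx0 : (2 : ℝ) ≤ c * Real.log c ^ 2 := by nlinarith [sq_nonneg (Real.log c - 4)]
  have hle : c * Real.log c ^ 2 ≤ burnIn Δ := Nat.le_ceil _
  refine ⟨by exact_mod_cast hx0.trans hle, fun m hm => ?_⟩
  have hm' : c * Real.log c ^ 2 ≤ m := hle.trans (by exact_mod_cast hm)
  have hexp : Real.exp 1 ≤ c * Real.log c ^ 2 := by
    have := Real.exp_one_lt_d9
    nlinarith [sq_nonneg (Real.log c - 4)]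
  have hanti := Real.log_div_self_antitoneOn (Set.mem_ofPred.2 hexp)
    (Set.mem_ofPred.2 (hexp.trans hm')) hm'
  -- With `L = log c > 4` the left side is `L + 2 log L ≤ 3L - 2 ≤ L²`.
  have hlog : Real.log (c * Real.log c ^ 2) ≤ Real.log c ^ 2 := by
    rw [Real.log_mul (by positivity) (by positivity), Real.log_pow]
    have := Real.log_le_sub_one_of_pos (show 0 < Real.log c by linarith)
    push_cast
    nlinarith
  have hmpos : (0 : ℝ) < m := by linarith
  have h2 : Real.log m / m ≤ 1 / c := by
    refine hanti.trans ?_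
    rw [div_le_div_iff₀ (by positivity) (by positivity)]
    nlinarith
  rw [div_le_div_iff₀ hmpos (by positivity), one_mul, hc, mul_div_assoc',
    div_le_iff₀ (by positivity)] at h2
  linarith

theorem monotone_sqrt_mul_log {a b : ℝ} (ha : 1 ≤ a) (hab : a ≤ b) :
    Real.sqrt (a * Real.log a) ≤ Real.sqrt (b * Real.log b) := by
  refine Real.sqrt_le_sqrt (mul_le_mul hab (Real.log_le_log (by linarith) hab)
    (Real.log_nonneg ha) (by linarith))

section Pair

variable {Ω : Type*} [MeasurableSpace Ω] {P : Measure Ω}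
  {Y : Option (Bool × ℕ) → Ω → ℝ} {ν : Bool → ℝ}

theorem PairModel.measureReal_noise_gt (h : PairModel P Y ν) (v : ℝ) :
    P.real {ω | v < Y none ω} = gaussianTail v := by
  rw [gaussianTail_eq, ← h.law, map_measureReal_apply (h.measurable none) measurableSet_Ioi]
  rfl

/-- The sum of the first `m` reward differences. -/
noncomputable def pairDiff (Y : Option (Bool × ℕ) → Ω → ℝ) (m : ℕ) (ω : Ω) : ℝ :=
  ∑ j ∈ Finset.range m, (Y (some (true, j)) ω - Y (some (false, j)) ω)

theorem PairModel.measureReal_pairDiff_lt_le [IsProbabilityMeasure P] (h : PairModel P Y ν) {Δ : ℝ}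
    (hΔ : Δ = ν true - ν false) (h0 : 0 < Δ) (h1 : Δ ≤ 1) {m : ℕ} (hm : burnIn Δ ≤ m) :
    P.real {ω | pairDiff Y m ω < 4 * Real.sqrt (m * Real.log m)} ≤ 1 / 8 * (1 / (m : ℝ) ^ 2) := by
  obtain ⟨hT, hlog⟩ := burnIn_bounds h0 h1
  have hm2 : (2 : ℝ) ≤ m := by exact_mod_cast hT.trans hm
  have hl0 : 0 ≤ Real.log m := Real.log_nonneg (by linarith)
  set r := 4 * Real.sqrt (m * Real.log m) with hr
  have hr0 : 0 ≤ r := by positivity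
  have hr2 : r ^ 2 = 16 * (m * Real.log m) := by
    rw [hr, mul_pow, Real.sq_sqrt (by positivity)]; norm_num
  -- The drift is at least twice the threshold, so falling below the threshold is a deviation of at
  -- least `r`; Hoeffding's inequality then gives `m⁻¹⁶`, far better than needed.
  have hrm : 2 * r ≤ m * Δ := by
    refine abs_le_of_sq_le_sq' ?_ (by positivity) |>.2
    have := hlog m hm
    nlinarith
  calc P.real {ω | pairDiff Y m ω < r}
      ≤ P.real {ω | r ≤ m * (ν true - ν false) - pairDiff Y m ω} := by
        refine measureReal_mono fun ω hω => ?_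
        simp only [Set.mem_ofPred_eq] at hω ⊢
        rw [← hΔ]
        linarith
    _ ≤ Real.exp (-(r ^ 2 / m)) := h.measureReal_diff_le m hr0
    _ = ((m : ℝ) ^ 16)⁻¹ := by
        rw [hr2, show 16 * (m * Real.log m) / m = 16 * Real.log m by field_simp, Real.exp_neg,
          mul_comm, Real.exp_mul, Real.exp_log (by linarith)]
        norm_cast
    _ ≤ 1 / 8 * (1 / (m : ℝ) ^ 2) := by
        rw [show 1 / 8 * (1 / (m : ℝ) ^ 2) = (8 * (m : ℝ) ^ 2)⁻¹ by field_simp]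
        refine inv_anti₀ (by positivity) ?_
        have : (2 : ℝ) ^ 14 ≤ (m : ℝ) ^ 14 := pow_le_pow_left₀ (by norm_num) hm2 14
        calc 8 * (m : ℝ) ^ 2 ≤ (m : ℝ) ^ 14 * (m : ℝ) ^ 2 := by
              gcongr; linarith
          _ = (m : ℝ) ^ 16 := by ring

theorem PairModel.measurable_pairDiff (h : PairModel P Y ν) (m : ℕ) :
    Measurable (pairDiff Y m) :=
  Finset.measurable_sum _ fun _ _ => (h.measurable _).sub (h.measurable _)

/-- Union bound over the levels: the failure probabilities add up to at most `(1 / 8) (π² / 6)`, and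
already `π ≤ 4` makes this at most `1 / 3`. -/
theorem PairModel.half_le_measureReal [IsProbabilityMeasure P] (h : PairModel P Y ν) {Δ : ℝ}
    (hΔ : Δ = ν true - ν false) (h0 : 0 < Δ) (h1 : Δ ≤ 1) :
    1 / 2 ≤ P.real {ω | ∀ m, burnIn Δ ≤ m → 4 * Real.sqrt (m * Real.log m) ≤ pairDiff Y m ω} := by
  set A := {ω | ∀ m : ℕ, burnIn Δ ≤ m → 4 * Real.sqrt (m * Real.log m) ≤ pairDiff Y m ω}
  have hA : MeasurableSet A := by
    simp only [A, Set.ofPred_forall]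
    exact MeasurableSet.iInter fun m => MeasurableSet.iInter fun _ =>
      measurableSet_le measurable_const (h.measurable_pairDiff m)
  have hsum := hasSum_zeta_two.mul_left (1 / 8)
  have hcompl : P Aᶜ ≤ ENNReal.ofReal (1 / 2) := by
    calc P Aᶜ ≤ P (⋃ m : ℕ, {ω | burnIn Δ ≤ m ∧
            pairDiff Y m ω < 4 * Real.sqrt (m * Real.log m)}) := by
          refine measure_mono fun ω hω => ?_
          simp only [A, Set.mem_compl_iff, Set.mem_ofPred_eq, not_forall, not_le] at hω
          obtain ⟨m, hm, hlt⟩ := hω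
          exact Set.mem_iUnion.2 ⟨m, hm, hlt⟩
      _ ≤ ∑' m : ℕ, P {ω | burnIn Δ ≤ m ∧ pairDiff Y m ω < 4 * Real.sqrt (m * Real.log m)} :=
          measure_iUnion_le _
      _ ≤ ∑' m : ℕ, ENNReal.ofReal (1 / 8 * (1 / (m : ℝ) ^ 2)) := by
          refine ENNReal.tsum_le_tsum fun m => ?_
          by_cases hm : burnIn Δ ≤ m
          · simp only [hm, true_and]
            rw [← ofReal_measureReal]
            exact ENNReal.ofReal_le_ofReal (h.measureReal_pairDiff_lt_le hΔ h0 h1 hm)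
          · simp [hm]
      _ = ENNReal.ofReal (1 / 8 * (Real.pi ^ 2 / 6)) := by
          rw [← ENNReal.ofReal_tsum_of_nonneg (fun m => by positivity) hsum.summable, hsum.tsum_eq]
      _ ≤ ENNReal.ofReal (1 / 2) := by
          refine ENNReal.ofReal_le_ofReal ?_
          nlinarith [Real.pi_pos, Real.pi_le_four]
  have h2 : P.real Aᶜ ≤ 1 / 2 := ENNReal.toReal_le_of_le_ofReal (by norm_num) hcompl
  rw [probReal_compl_eq_one_sub hA] at h2
  linarith

theorem PairModel.indep_noise (h : PairModel P Y ν) :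
    Indep (⨆ i ∈ ({none} : Set (Option (Bool × ℕ))), MeasurableSpace.comap (Y i) inferInstance)
      (⨆ i ∈ ({none}ᶜ : Set (Option (Bool × ℕ))), MeasurableSpace.comap (Y i) inferInstance) P :=
  indep_iSup_of_disjoint (fun i => (h.measurable i).comap_le) h.indep disjoint_compl_right

/-- Two independent events suffice. If `Z > f(T₀)`, all levels up to `T₀` are passed for certain,
since `m` reward differences sum to at least `-m`. If the differences alone beat the threshold from
`T₀` on, the positive perturbation only helps. The factor `1 / 2` in `beta` is the bound for the
second event. -/
theorem PairModel.beta_le [IsProbabilityMeasure P] (h : PairModel P Y ν) {Δ : ℝ}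
    (hΔ : Δ = ν true - ν false) (h0 : 0 < Δ) (h1 : Δ ≤ 1) :
    beta Δ ≤ P.real {ω | ∀ m : ℕ, 1 ≤ m →
      4 * Real.sqrt (m * Real.log m) ≤ Y none ω + pairDiff Y m ω} := by
  have hT := (burnIn_bounds h0 h1).1
  set A := {ω | ∀ m : ℕ, burnIn Δ ≤ m → 4 * Real.sqrt (m * Real.log m) ≤ pairDiff Y m ω}
  set B := {ω | envelope (burnIn Δ) < Y none ω}
  have hY (i : Option (Bool × ℕ)) (hi : i ∈ ({none}ᶜ : Set (Option (Bool × ℕ)))) :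
      Measurable[⨆ i ∈ ({none}ᶜ : Set (Option (Bool × ℕ))),
        MeasurableSpace.comap (Y i) inferInstance] (Y i) :=
    Measurable.mono (comap_measurable _) (le_biSup
      (fun i => MeasurableSpace.comap (Y i) inferInstance) hi) le_rfl
  have hA : MeasurableSet[⨆ i ∈ ({none}ᶜ : Set (Option (Bool × ℕ))),
      MeasurableSpace.comap (Y i) inferInstance] A := by
    simp only [A, Set.ofPred_forall]
    refine MeasurableSet.iInter fun m => MeasurableSet.iInter fun _ => ?_
    have hd : Measurable[⨆ i ∈ ({none}ᶜ : Set (Option (Bool × ℕ))),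
        MeasurableSpace.comap (Y i) inferInstance] (pairDiff Y m) :=
      Finset.measurable_sum _ fun j _ => (hY _ (by simp)).sub (hY _ (by simp))
    exact hd measurableSet_Ici
  have hB : MeasurableSet[⨆ i ∈ ({none} : Set (Option (Bool × ℕ))),
      MeasurableSpace.comap (Y i) inferInstance] B :=
    le_biSup (fun i => MeasurableSpace.comap (Y i) inferInstance) (Set.mem_singleton none) _
      ⟨Set.Ioi (envelope (burnIn Δ)), measurableSet_Ioi, rfl⟩
  have hBA : P.real (B ∩ A) = P.real B * P.real A := by
    simp only [measureReal_def, ← ENNReal.toReal_mul]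
    rw [(Indep_iff _ _ _).1 h.indep_noise B A hB hA]
  have hae : ∀ᵐ ω ∂P, ∀ i, Y (some i) ω ∈ Set.Icc (0 : ℝ) 1 := ae_all_iff.2 h.mem
  calc beta Δ = gaussianTail (envelope (burnIn Δ)) * (1 / 2) := by rw [beta]; ring
    _ ≤ P.real B * P.real A := by
        rw [h.measureReal_noise_gt]
        exact mul_le_mul_of_nonneg_left (h.half_le_measureReal hΔ h0 h1) (gaussianTail_pos _).le
    _ = P.real (B ∩ A) := hBA.symm
    _ ≤ _ := by
        refine ENNReal.toReal_mono (measure_ne_top _ _) (measure_mono_ae ?_)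
        filter_upwards [hae] with ω hω hωBA
        obtain ⟨hB, hA⟩ := hωBA
        intro m hm
        have hm1 : (1 : ℝ) ≤ m := by exact_mod_cast hm
        have hB' : (burnIn Δ : ℝ) + 4 * Real.sqrt (burnIn Δ * Real.log (burnIn Δ)) < Y none ω := hB
        rcases le_total (burnIn Δ) m with hTm | hmT
        · have := hA m hTm
          have h3 : 0 ≤ (burnIn Δ : ℝ) + 4 * Real.sqrt (burnIn Δ * Real.log (burnIn Δ)) := by
            positivity
          linarith
        · have hmT' : (m : ℝ) ≤ burnIn Δ := by exact_mod_cast hmT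
          have h3 := monotone_sqrt_mul_log hm1 hmT'
          have h4 : -(m : ℝ) ≤ pairDiff Y m ω := by
            have : ∑ j ∈ Finset.range m, (-1 : ℝ) ≤ pairDiff Y m ω :=
              Finset.sum_le_sum fun j _ => by
                have h5 := (hω (true, j)).1
                have h6 := (hω (false, j)).2
                linarith
            simpa using this
          linarith

theorem PairModel.beta_le_passes [IsProbabilityMeasure P] (h : PairModel P Y ν) {Δ : ℝ}
    (hΔ : Δ = |ν true - ν false|) (h0 : 0 < Δ) (h1 : Δ ≤ 1) :
    beta Δ ≤ P.real {ω | ∀ m : ℕ, 1 ≤ m →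
      Passes (fun j => Y (some (true, j)) ω) (fun j => Y (some (false, j)) ω) (Y none ω) m} := by
  rcases abs_cases (ν true - ν false) with ⟨h2, -⟩ | ⟨h2, -⟩
  · refine (h.beta_le (hΔ.trans h2) h0 h1).trans (measureReal_mono fun ω hω m hm => ?_)
    exact (hω m hm).trans (le_abs_self _)
  · refine (h.swap.neg_noise.beta_le (Δ := Δ) (by simp [hΔ, h2]) h0 h1).trans
      (measureReal_mono fun ω hω m hm => ?_)
    refine (hω m hm).trans (le_trans (le_of_eq ?_) (neg_le_abs _))
    simp only [Option.elim_none, pairDiff, Option.elim_some, Bool.not_true, Bool.not_false, neg_add]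
    rw [← Finset.sum_neg_distrib]
    simp

end Pair

/-! ### Unlikely choices of the index policy -/

/-- After `s` plays the index policy prefers an arm with rewards `y₂` that was pulled at least `l`
times to an arm with rewards `y₁`. -/
def Misjudges (y₁ y₂ : ℕ → ℝ) (l s : ℕ) : Prop :=
  ∃ N₁ N₂, 1 ≤ N₁ ∧ l ≤ N₂ ∧ N₁ + N₂ = s ∧ ucbIndex y₁ N₁ s ≤ ucbIndex y₂ N₂ s

/-- Among `s` plays, the arm with rewards `y₂` is pulled about `√s` times at most, although the
index policy prefers an arm with rewards `y₁` near the end. -/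
def Unbalanced (y₁ y₂ : ℕ → ℝ) (s : ℕ) : Prop :=
  ∃ k N, 1 ≤ k ∧ k ≤ Nat.sqrt s ∧ s ≤ N + Nat.sqrt s + 1 ∧ N ≤ s ∧
    ucbIndex y₂ k (N + k) ≤ ucbIndex y₁ N (N + k)

/-- A necessary condition for an epoch to have length at least `s`. -/
def LongStay (y₁ y₂ : ℕ → ℝ) (w : ℝ) (s : ℕ) : Prop :=
  s < 402 * 402 ∨ Passes y₁ y₂ w (Nat.sqrt s) ∨ Unbalanced y₁ y₂ s ∨ Unbalanced y₂ y₁ s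

/-- Let `M = ⌊√s⌋`. If both arms have more than `M` pulls, the test at level `M` was passed.
Otherwise one arm has at most `M` pulls, and the latest pull of the other arm shows the index policy
preferring an arm that already had at least `s - M - 1` pulls. -/
theorem longStay_of_ep {S : Type*} (tie : TieRule S) (x : ℕ → ℕ → ℝ) (z : ℕ → ℝ) (u : S) (t : ℕ)
    (e : Epoch) (he : ep tie x z u t = e) :
    LongStay (x e.start) (x (e.start + 1)) (z e.start) (e.n₁ + e.n₂) := by
  rcases lt_or_ge (e.n₁ + e.n₂) (402 * 402) with hs | hs
  · exact Or.inl hs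
  right
  set M := Nat.sqrt (e.n₁ + e.n₂) with hM
  have hM1 : 402 ≤ M := Nat.le_sqrt.2 hs
  have hM2 : M * M ≤ e.n₁ + e.n₂ := Nat.sqrt_le _
  have hM3 : 402 * M ≤ e.n₁ + e.n₂ := (Nat.mul_le_mul_right M hM1).trans hM2
  rcases lt_or_ge M (min e.n₁ e.n₂) with hlt | hge
  · exact Or.inl (passes_of_lt_min tie x z u t e he M (by omega) hlt)
  right
  rcases min_le_iff.1 hge with h | h
  · right
    obtain ⟨k, hk, hk', hle⟩ := ucbIndex_le_of_two_le_snd tie x z u t e he (by omega)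
    exact ⟨k, e.n₂ - 1, hk, hk'.trans h, by omega, by omega, by exact_mod_cast hle⟩
  · left
    obtain ⟨k, hk, hk', hle⟩ := ucbIndex_le_of_two_le_fst tie x z u t e he (by omega)
    exact ⟨k, e.n₁ - 1, hk, hk'.trans h, by omega, by omega, by exact_mod_cast hle⟩

theorem exp_neg_mul_log {s : ℝ} (hs : 0 < s) (k : ℕ) :
    Real.exp (-(k * Real.log s)) = (s ^ k)⁻¹ := by
  rw [Real.exp_neg, mul_comm, Real.exp_mul, Real.exp_log hs, Real.rpow_natCast]

section Pair

variable {Ω : Type*} [MeasurableSpace Ω] {P : Measure Ω} [IsProbabilityMeasure P]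
  {Y : Option (Bool × ℕ) → Ω → ℝ} {ν : Bool → ℝ}

theorem PairModel.measureReal_avg_ge_le (h : PairModel P Y ν) (b : Bool) {N : ℕ} (hN : 1 ≤ N)
    {ρ : ℝ} (hρ : 0 ≤ ρ) :
    P.real {ω | ν b + ρ ≤ (∑ j ∈ Finset.range N, Y (some (b, j)) ω) / N} ≤
      Real.exp (-(2 * N * ρ ^ 2)) := by
  have hN' : (0 : ℝ) < N := by exact_mod_cast hN
  refine le_trans (measureReal_mono fun ω hω => ?_)
    ((h.measureReal_upper_le b N (r := N * ρ) (by positivity)).trans (le_of_eq ?_))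
  · simp only [Set.mem_ofPred_eq, Finset.sum_sub_distrib, Finset.sum_const, Finset.card_range,
      nsmul_eq_mul] at hω ⊢
    rw [le_div_iff₀ hN'] at hω
    linarith
  · congr 2
    field_simp

theorem PairModel.measureReal_avg_le_le (h : PairModel P Y ν) (b : Bool) {N : ℕ} (hN : 1 ≤ N)
    {ρ : ℝ} (hρ : 0 ≤ ρ) :
    P.real {ω | (∑ j ∈ Finset.range N, Y (some (b, j)) ω) / N ≤ ν b - ρ} ≤
      Real.exp (-(2 * N * ρ ^ 2)) := by
  have hN' : (0 : ℝ) < N := by exact_mod_cast hN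
  refine le_trans (measureReal_mono fun ω hω => ?_)
    ((h.measureReal_lower_le b N (r := N * ρ) (by positivity)).trans (le_of_eq ?_))
  · simp only [Set.mem_ofPred_eq, Finset.sum_sub_distrib, Finset.sum_const, Finset.card_range,
      nsmul_eq_mul] at hω ⊢
    rw [div_le_iff₀ hN'] at hω
    linarith
  · congr 2
    field_simp

/-- The UCB1 argument: if both averages respect their confidence radii, the wrong preference forces
`Δ < 2 √(2 log s / N₂)`, which `N₂ ≥ l` excludes. Each radius fails with probability at most `s⁻⁴`,
and the union runs over two arms and at most `s` counts. -/
theorem PairModel.measureReal_misjudges_le (h : PairModel P Y ν) {b : Bool} {Δ : ℝ}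
    (hΔ : Δ = ν b - ν (!b)) (h0 : 0 < Δ) {l s : ℕ} (hl : 1 ≤ l) (hs : 1 ≤ s)
    (hls : 8 * Real.log s ≤ Δ ^ 2 * l) :
    P.real {ω | Misjudges (fun j => Y (some (b, j)) ω) (fun j => Y (some (!b, j)) ω) l s} ≤
      2 / (s : ℝ) ^ 3 := by
  have hs' : (1 : ℝ) ≤ s := by exact_mod_cast hs
  have hlog : 0 ≤ Real.log s := Real.log_nonneg hs'
  set ρ : ℕ → ℝ := fun N => Real.sqrt (2 * Real.log s / N) with hρ
  have hρ2 (N : ℕ) (hN : 1 ≤ N) : 2 * (N : ℝ) * ρ N ^ 2 = (4 : ℕ) * Real.log s := by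
    have hN' : (0 : ℝ) < N := by exact_mod_cast hN
    rw [hρ]
    simp only
    rw [Real.sq_sqrt (by positivity)]
    field_simp
    push_cast
    ring
  set A : ℕ → Set Ω := fun N => {ω | (∑ j ∈ Finset.range N, Y (some (b, j)) ω) / N ≤ ν b - ρ N}
  set B : ℕ → Set Ω := fun N =>
    {ω | ν (!b) + ρ N ≤ (∑ j ∈ Finset.range N, Y (some (!b, j)) ω) / N}
  have hA (N : ℕ) (hN : 1 ≤ N) : P.real (A N) ≤ ((s : ℝ) ^ 4)⁻¹ := by
    have := h.measureReal_avg_le_le b hN (ρ := ρ N) (Real.sqrt_nonneg _)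
    rwa [hρ2 N hN, exp_neg_mul_log (by linarith)] at this
  have hB (N : ℕ) (hN : 1 ≤ N) : P.real (B N) ≤ ((s : ℝ) ^ 4)⁻¹ := by
    have := h.measureReal_avg_ge_le (!b) hN (ρ := ρ N) (Real.sqrt_nonneg _)
    rwa [hρ2 N hN, exp_neg_mul_log (by linarith)] at this
  calc _ ≤ P.real (⋃ N ∈ Finset.Icc 1 s, (A N ∪ B N)) := by
        refine measureReal_mono (fun ω hω => ?_) (measure_ne_top _ _)
        obtain ⟨N₁, N₂, h1, h2, h3, h4⟩ := hω
        by_contra hcon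
        simp only [Set.mem_iUnion, Finset.mem_Icc, Set.mem_union, not_exists, not_or] at hcon
        have hA' := (hcon N₁ ⟨h1, by omega⟩).1
        have hB' := (hcon N₂ ⟨by omega, by omega⟩).2
        simp only [A, B, Set.mem_ofPred_eq, not_le] at hA' hB'
        have hlt : Δ < 2 * ρ N₂ := by
          unfold ucbIndex at h4
          change _ + ρ N₁ ≤ _ + ρ N₂ at h4
          linarith
        have hsq : Δ ^ 2 < (2 * ρ N₂) ^ 2 := pow_lt_pow_left₀ hlt h0.le two_ne_zero
        have hN2 : (0 : ℝ) < N₂ := by exact_mod_cast (show 0 < N₂ by omega)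
        have hl2 : (l : ℝ) ≤ N₂ := by exact_mod_cast h2
        have h5 := hρ2 N₂ (by omega)
        push_cast at h5
        nlinarith [mul_le_mul_of_nonneg_left hl2 (sq_nonneg Δ)]
    _ ≤ ∑ N ∈ Finset.Icc 1 s, P.real (A N ∪ B N) := measureReal_biUnion_finset_le _ _
    _ ≤ ∑ N ∈ Finset.Icc 1 s, 2 * ((s : ℝ) ^ 4)⁻¹ := by
        refine Finset.sum_le_sum fun N hN => (measureReal_union_le _ _).trans ?_
        rw [Finset.mem_Icc] at hN
        linarith [hA N hN.1, hB N hN.1]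
    _ = 2 / (s : ℝ) ^ 3 := by
        rw [Finset.sum_const, Nat.card_Icc, nsmul_eq_mul, Nat.add_sub_cancel]
        field_simp

theorem PairModel.measureReal_prefers_le (h : PairModel P Y ν) (hν : ν true = ν false) (b : Bool)
    {k N : ℕ} (hk : 1 ≤ k) (hkN : 400 * k ≤ N) :
    P.real {ω | ucbIndex (fun j => Y (some (!b, j)) ω) k (N + k) ≤
      ucbIndex (fun j => Y (some (b, j)) ω) N (N + k)} ≤ 2 / ((N + k : ℕ) : ℝ) ^ 3 := by
  set s : ℕ := N + k with hs
  have hs' : (1 : ℝ) ≤ s := by exact_mod_cast (show 1 ≤ s by omega)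
  have hlog : 0 ≤ Real.log s := Real.log_nonneg hs'
  have hb : ν (!b) = ν b := by cases b <;> simp [hν]
  set ρ : ℕ → ℝ := fun N => Real.sqrt (2 * Real.log s / N) with hρ
  have hρ0 (N : ℕ) : 0 ≤ ρ N := Real.sqrt_nonneg _
  have hρ2 (N : ℕ) (hN : 1 ≤ N) : (N : ℝ) * ρ N ^ 2 = 2 * Real.log s := by
    have hN' : (0 : ℝ) < N := by exact_mod_cast hN
    rw [hρ]
    simp only
    rw [Real.sq_sqrt (by positivity)]
    field_simp
  have hmono {e : ℝ} (he : 3 * Real.log s ≤ e) : Real.exp (-e) ≤ ((s : ℝ) ^ 3)⁻¹ := by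
    rw [← exp_neg_mul_log (by linarith)]
    exact Real.exp_le_exp.2 (by push_cast; linarith)
  -- The fraction `9 / 10` serves two ends: the exponent `4 · 0.81` still exceeds `3`, and the
  -- remaining `ρ k / 10` covers `2 ρ N`. The latter needs `20 ρ N ≤ ρ k`, whence the ratio `400 =
  -- 20²` of the counts.
  have hA := h.measureReal_avg_le_le (!b) hk (ρ := 9 / 10 * ρ k)
    (mul_nonneg (by norm_num) (hρ0 k))
  have hB := h.measureReal_avg_ge_le b (show 1 ≤ N by omega) (ρ := ρ N) (hρ0 N)
  have hA' := hA.trans (hmono (by linarith [hρ2 k hk]))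
  have hB' := hB.trans (hmono (by linarith [hρ2 N (by omega)]))
  rw [hb] at hA'
  have hcmp : 20 * ρ N ≤ ρ k := by
    refine abs_le_of_sq_le_sq' ?_ (hρ0 k) |>.2
    have hk' : (0 : ℝ) < k := by exact_mod_cast hk
    have hkN' : 400 * (k : ℝ) ≤ N := by exact_mod_cast hkN
    have h1 := hρ2 k hk
    have h2 := hρ2 N (by omega)
    have h3 : 400 * (k : ℝ) * ρ N ^ 2 ≤ k * ρ k ^ 2 := by
      rw [h1, ← h2]
      exact mul_le_mul_of_nonneg_right hkN' (sq_nonneg _)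
    have h4 : (k : ℝ) * (20 * ρ N) ^ 2 ≤ k * ρ k ^ 2 := by linarith
    exact le_of_mul_le_mul_left h4 hk'
  refine (measureReal_mono (s₂ := _ ∪ _) (fun ω hω => ?_) (measure_ne_top _ _)).trans
    ((measureReal_union_le _ _).trans
    ((add_le_add hA' hB').trans (le_of_eq ?_)))
  · by_contra hcon
    simp only [Set.mem_union, Set.mem_ofPred_eq, not_or, not_le] at hcon hω
    unfold ucbIndex at hω
    change _ + ρ k ≤ _ + ρ N at hω
    linarith [hcon.1, hcon.2]
  · rw [div_eq_mul_inv]; ring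

/-- Only `M (M + 2) ≤ 2s` pairs of counts are possible, each with total at least `s / 2` and so of
probability at most `16 / s³`. -/
theorem PairModel.measureReal_unbalanced_le (h : PairModel P Y ν) (hν : ν true = ν false)
    (b : Bool) {s : ℕ} (hs : 402 * 402 ≤ s) :
    P.real {ω | Unbalanced (fun j => Y (some (b, j)) ω) (fun j => Y (some (!b, j)) ω) s} ≤
      32 / (s : ℝ) ^ 2 := by
  set M := Nat.sqrt s with hM
  have hM1 : 402 ≤ M := Nat.le_sqrt.2 hs
  have hM2 : M * M ≤ s := Nat.sqrt_le _
  have hM3 : 402 * M ≤ s := (Nat.mul_le_mul_right M hM1).trans hM2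
  have hs0 : (0 : ℝ) < s := by exact_mod_cast (show 0 < s by omega)
  set A : ℕ × ℕ → Set Ω := fun p => {ω | ucbIndex (fun j => Y (some (!b, j)) ω) p.1 (p.2 + p.1) ≤
      ucbIndex (fun j => Y (some (b, j)) ω) p.2 (p.2 + p.1)}
  calc _ ≤ P.real (⋃ p ∈ Finset.Icc 1 M ×ˢ Finset.Icc (s - M - 1) s, A p) := by
        refine measureReal_mono (fun ω hω => ?_) (measure_ne_top _ _)
        obtain ⟨k, N, h1, h2, h3, h4, h5⟩ := hω
        simp only [Set.mem_iUnion]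
        refine ⟨(k, N), ?_, h5⟩
        simp only [Finset.mem_product, Finset.mem_Icc]
        omega
    _ ≤ ∑ p ∈ Finset.Icc 1 M ×ˢ Finset.Icc (s - M - 1) s, P.real (A p) :=
        measureReal_biUnion_finset_le _ _
    _ ≤ ∑ p ∈ Finset.Icc 1 M ×ˢ Finset.Icc (s - M - 1) s, 16 / (s : ℝ) ^ 3 := by
        refine Finset.sum_le_sum fun p hp => ?_
        simp only [Finset.mem_product, Finset.mem_Icc] at hp
        -- The cutoff `402` enters here: `s ≥ 402 M` gives `N ≥ 401 M - 1 ≥ 400 k`.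
        refine (h.measureReal_prefers_le hν b hp.1.1 (by omega)).trans ?_
        have h1 : (s : ℝ) / 2 ≤ ((p.2 + p.1 : ℕ) : ℝ) := by
          rw [div_le_iff₀ two_pos]
          exact_mod_cast (show s ≤ (p.2 + p.1) * 2 by omega)
        calc 2 / ((p.2 + p.1 : ℕ) : ℝ) ^ 3 ≤ 2 / ((s : ℝ) / 2) ^ 3 := by gcongr
          _ = 16 / (s : ℝ) ^ 3 := by field_simp; norm_num
    _ ≤ 32 / (s : ℝ) ^ 2 := by
        rw [Finset.sum_const, Finset.card_product, Nat.card_Icc, Nat.card_Icc, nsmul_eq_mul]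
        have h1 : (M + 1 - 1) * (s + 1 - (s - M - 1)) ≤ 2 * s := by
          rw [show M + 1 - 1 = M by omega, show s + 1 - (s - M - 1) = M + 2 by omega]
          nlinarith
        have h2 : (((M + 1 - 1) * (s + 1 - (s - M - 1)) : ℕ) : ℝ) ≤ 2 * s := by exact_mod_cast h1
        calc _ ≤ 2 * (s : ℝ) * (16 / (s : ℝ) ^ 3) := by gcongr
          _ = 32 / (s : ℝ) ^ 2 := by field_simp; norm_num

/-- The exponent is `16 m log m / (m + 2) ≥ 4 log m`. The fourth power is what the level `m ≈ √s`
needs to yield `s⁻²`. -/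
theorem PairModel.measureReal_noise_ge_le (h : PairModel P Y ν) (hν : ν true = ν false) {m : ℕ}
    (hm : 2 ≤ m) :
    P.real {ω | 4 * Real.sqrt (m * Real.log m) ≤ Y none ω + pairDiff Y m ω} ≤
      ((m : ℝ) ^ 4)⁻¹ := by
  have hm' : (2 : ℝ) ≤ m := by exact_mod_cast hm
  have hl0 : 0 ≤ Real.log m := Real.log_nonneg (by linarith)
  refine (h.measureReal_noise_add_le hν m (by positivity)).trans ?_
  rw [← exp_neg_mul_log (by linarith), Real.exp_le_exp, neg_le_neg_iff, mul_pow,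
    Real.sq_sqrt (by positivity), le_div_iff₀ (by linarith)]
  push_cast
  nlinarith [mul_nonneg hl0 (show (0 : ℝ) ≤ m - 2 by linarith)]

theorem PairModel.measureReal_passes_le (h : PairModel P Y ν) (hν : ν true = ν false) {m : ℕ}
    (hm : 2 ≤ m) :
    P.real {ω | Passes (fun j => Y (some (true, j)) ω) (fun j => Y (some (false, j)) ω)
      (Y none ω) m} ≤ 2 * ((m : ℝ) ^ 4)⁻¹ := by
  have h1 := h.measureReal_noise_ge_le hν hm
  have h2 := h.swap.neg_noise.measureReal_noise_ge_le hν.symm hm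
  refine (measureReal_mono (s₂ := _ ∪ _) (fun ω hω => ?_) (measure_ne_top _ _)).trans
    ((measureReal_union_le _ _).trans
    ((add_le_add h1 h2).trans (two_mul _).ge))
  rw [Set.mem_ofPred_eq, Passes] at hω
  rcases le_abs.1 hω with hω | hω
  · exact Or.inl hω
  · right
    refine hω.trans (le_of_eq ?_)
    simp only [Option.elim_none, pairDiff, Option.elim_some, Bool.not_true, Bool.not_false, neg_add]
    rw [← Finset.sum_neg_distrib]
    simp

/-- The constant `402⁴` makes the bound trivial below the cutoff `402²`; above it the three failure
modes contribute at most `96 / s²`. What matters is that the bound is summable in `s`. -/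
theorem PairModel.measureReal_longStay_le (h : PairModel P Y ν) (hν : ν true = ν false) {s : ℕ}
    (hs : 1 ≤ s) :
    P.real {ω | LongStay (fun j => Y (some (true, j)) ω) (fun j => Y (some (false, j)) ω)
      (Y none ω) s} ≤ 402 ^ 4 / (s : ℝ) ^ 2 := by
  have hs0 : (0 : ℝ) < s := by exact_mod_cast hs
  rcases lt_or_ge s (402 * 402) with hlt | hge
  · refine measureReal_le_one.trans ?_
    rw [le_div_iff₀ (by positivity), one_mul]
    have : (s : ℝ) ≤ 402 ^ 2 := by exact_mod_cast (show s ≤ 402 ^ 2 by omega)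
    calc (s : ℝ) ^ 2 ≤ (402 ^ 2) ^ 2 := by gcongr
      _ = 402 ^ 4 := by norm_num
  · set M := Nat.sqrt s with hM
    have hM1 : 402 ≤ M := Nat.le_sqrt.2 hge
    have h1 := h.measureReal_passes_le hν (m := M) (by omega)
    have h2 := h.measureReal_unbalanced_le hν true hge
    have h3 := h.measureReal_unbalanced_le hν false hge
    have h4 : 2 * ((M : ℝ) ^ 4)⁻¹ ≤ 32 / (s : ℝ) ^ 2 := by
      have h5 : s ≤ 4 * (M * M) := by
        have : s ≤ M * M + M + M := Nat.sqrt_le_add s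
        nlinarith
      have h6 : (s : ℝ) ≤ 4 * (M : ℝ) ^ 2 := by
        rw [sq]; exact_mod_cast h5
      have hM0 : (0 : ℝ) < M := by exact_mod_cast (show 0 < M by omega)
      rw [← div_eq_mul_inv, div_le_div_iff₀ (by positivity) (by positivity)]
      have h7 : (s : ℝ) ^ 2 ≤ (4 * (M : ℝ) ^ 2) ^ 2 := by gcongr
      nlinarith
    calc _ ≤ 2 * ((M : ℝ) ^ 4)⁻¹ + (32 / (s : ℝ) ^ 2 + 32 / (s : ℝ) ^ 2) := by
          refine (measureReal_mono (s₂ := _ ∪ (_ ∪ _)) (fun ω hω => ?_) (measure_ne_top _ _)).trans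
            ((measureReal_union_le _ _).trans (add_le_add h1
              ((measureReal_union_le _ _).trans (add_le_add h2 h3))))
          rcases hω with hω | hω
          · omega
          · exact hω
      _ ≤ 96 / (s : ℝ) ^ 2 := by
          have : 32 / (s : ℝ) ^ 2 + (32 / (s : ℝ) ^ 2 + 32 / (s : ℝ) ^ 2) = 96 / (s : ℝ) ^ 2 := by
            ring
          linarith
      _ ≤ 402 ^ 4 / (s : ℝ) ^ 2 := by gcongr; norm_num

end Pair

/-! ### Measurability and independence in the model -/

instance : Finite ArmType :=
  Finite.of_injective (fun k : ArmType => match k with | .optimal => true | .inferior => false)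
    (by rintro (_ | _) (_ | _) h <;> simp_all)

section SubAlgebra

variable {Ω S : Type*} {m : MeasurableSpace Ω} (E : Env Ω S)

variable {E} in
theorem Env.measurable_path {a j : ℕ} (hκ : Measurable (E.κ a))
    (hX : ∀ k, Measurable (E.X a j k)) : Measurable fun ω => E.path ω a j := by
  have : Measurable fun p : Ω × ArmType => E.X a j p.2 p.1 :=
    measurable_from_prod_countable_left fun k => hX k
  exact this.comp (measurable_id.prodMk hκ)

theorem measurableSet_misjudges {y₁ y₂ : Ω → ℕ → ℝ} (h₁ : ∀ j, Measurable fun ω => y₁ ω j)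
    (h₂ : ∀ j, Measurable fun ω => y₂ ω j) (l s : ℕ) :
    MeasurableSet {ω | Misjudges (y₁ ω) (y₂ ω) l s} := by
  refine measurableSet_setOfPred.2 (Measurable.exists fun N₁ => Measurable.exists fun N₂ => ?_)
  refine measurable_const.and (measurable_const.and (measurable_const.and ?_))
  exact measurableSet_setOfPred.1
    (measurableSet_le (measurable_ucbIndex h₁ _ _) (measurable_ucbIndex h₂ _ _))

theorem measurable_unbalanced {y₁ y₂ : Ω → ℕ → ℝ} (h₁ : ∀ j, Measurable fun ω => y₁ ω j)
    (h₂ : ∀ j, Measurable fun ω => y₂ ω j) (s : ℕ) :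
    Measurable fun ω => Unbalanced (y₁ ω) (y₂ ω) s := by
  refine Measurable.exists fun k => Measurable.exists fun N => ?_
  refine measurable_const.and (measurable_const.and (measurable_const.and
    (measurable_const.and ?_)))
  exact measurableSet_setOfPred.1
    (measurableSet_le (measurable_ucbIndex h₂ _ _) (measurable_ucbIndex h₁ _ _))

theorem measurableSet_longStay {y₁ y₂ : Ω → ℕ → ℝ} {w : Ω → ℝ}
    (h₁ : ∀ j, Measurable fun ω => y₁ ω j) (h₂ : ∀ j, Measurable fun ω => y₂ ω j)
    (hw : Measurable w) (s : ℕ) : MeasurableSet {ω | LongStay (y₁ ω) (y₂ ω) (w ω) s} := by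
  refine measurableSet_setOfPred.2 (measurable_const.or (Measurable.or ?_ (Measurable.or ?_ ?_)))
  · exact measurableSet_setOfPred.1 (measurableSet_passes h₁ h₂ hw _)
  · exact measurable_unbalanced h₁ h₂ s
  · exact measurable_unbalanced h₂ h₁ s

theorem measurableSet_forall_passes {y₁ y₂ : Ω → ℕ → ℝ} {w : Ω → ℝ}
    (h₁ : ∀ j, Measurable fun ω => y₁ ω j) (h₂ : ∀ j, Measurable fun ω => y₂ ω j)
    (hw : Measurable w) : MeasurableSet {ω | ∀ m, 1 ≤ m → Passes (y₁ ω) (y₂ ω) (w ω) m} := by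
  simp only [Set.ofPred_forall]
  exact MeasurableSet.iInter fun m => MeasurableSet.iInter fun _ => measurableSet_passes h₁ h₂ hw m

/-- The run along the sample path `ω`: the epoch after the play at time `t`. -/
noncomputable def Env.epAt (tie : TieRule S) (t : ℕ) (ω : Ω) : Epoch :=
  ep tie (E.path ω) (fun a => E.Z a ω) (E.U ω) t

/-- The arm played at time `t + 1` and the number of its earlier pulls. -/
noncomputable def Env.pick (tie : TieRule S) (t : ℕ) (ω : Ω) : ℕ × ℕ :=
  (act tie (E.path ω) (fun a => E.Z a ω) (E.U ω) t).2

/-- A new epoch starts at time `a`. -/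
def Env.starts (tie : TieRule S) (a : ℕ) : Set Ω := {ω | (E.epAt tie a ω).start = a}

/-- The types of the arms queried at times `a` and `a + 1`. -/
def Env.types (a : ℕ) (k₁ k₂ : ArmType) : Set Ω := {ω | E.κ a ω = k₁ ∧ E.κ (a + 1) ω = k₂}

variable {E} [MeasurableSpace S] {tie : TieRule S}

/-- Overwriting with zero everything that belongs to arms queried from time `a` on does not change
the event, by `ep_congr_of_lt`. The σ-algebra on `Ω` is arbitrary, so that it can be taken to be the
one generated by the past. -/
theorem Env.measurableSet_starts
    (htie : ∀ t, Measurable (fun p : (ℕ → ℝ × ℝ) × S => tie t p.1 p.2))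
    {a : ℕ} (hκ : ∀ b < a, Measurable (E.κ b))
    (hX : ∀ b < a, ∀ j k, Measurable (E.X b j k)) (hZ : ∀ b < a, Measurable (E.Z b))
    (hU : Measurable E.U) : MeasurableSet (E.starts tie a) := by
  let x' : Ω → ℕ → ℕ → ℝ := fun ω b j => if b < a then E.path ω b j else 0
  let z' : Ω → ℕ → ℝ := fun ω b => if b < a then E.Z b ω else 0
  have hx' : Measurable x' := by
    refine measurable_pi_lambda _ fun b => measurable_pi_lambda _ fun j => ?_
    by_cases hb : b < a
    · simp only [x', hb, if_true]
      exact Env.measurable_path (hκ b hb) (hX b hb j)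
    · simp only [x', hb, if_false]
      exact measurable_const
  have hz' : Measurable z' := by
    refine measurable_pi_lambda _ fun b => ?_
    by_cases hb : b < a
    · simp only [z', hb, if_true]
      exact hZ b hb
    · simp only [z', hb, if_false]
      exact measurable_const
  have hm : Measurable fun ω => ep tie (x' ω) (z' ω) (E.U ω) a :=
    (measurable_ep htie a).comp (hx'.prodMk (hz'.prodMk hU))
  have heq : E.starts tie a = (fun ω => ep tie (x' ω) (z' ω) (E.U ω) a) ⁻¹' {e | e.start = a} := by
    ext ω
    simp only [Env.starts, Env.epAt, Set.mem_ofPred_eq, Set.mem_preimage]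
    rw [ep_congr_of_lt tie (E.U ω) (x' := x' ω) (z' := z' ω)
      (fun b hb => by ext j; simp [x', hb]) (fun b hb => by simp [z', hb])]
  rw [heq]
  exact hm trivial

/-- The same device with the single reward `(a, j)` overwritten; `act_eq_congr` shows that the event
is unchanged. -/
theorem Env.measurableSet_pick_eq
    (htie : ∀ t, Measurable (fun p : (ℕ → ℝ × ℝ) × S => tie t p.1 p.2))
    (t a j : ℕ) (hκ : ∀ b, Measurable (E.κ b))
    (hX : ∀ b i k, (b, i) ≠ (a, j) → Measurable (E.X b i k)) (hZ : ∀ b, Measurable (E.Z b))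
    (hU : Measurable E.U) : MeasurableSet {ω | E.pick tie t ω = (a, j)} := by
  let x' : Ω → ℕ → ℕ → ℝ := fun ω b i => if (b, i) = (a, j) then 0 else E.path ω b i
  have hx' : Measurable x' := by
    refine measurable_pi_lambda _ fun b => measurable_pi_lambda _ fun i => ?_
    by_cases hb : (b, i) = (a, j)
    · simp only [x', hb, if_true]
      exact measurable_const
    · simp only [x', hb, if_false]
      exact Env.measurable_path (hκ b) fun k => hX b i k hb
  have hz' : Measurable fun ω b => E.Z b ω := measurable_pi_lambda _ hZ
  have hm : Measurable fun ω => (act tie (x' ω) (fun b => E.Z b ω) (E.U ω) t).2 :=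
    ((measurable_act htie t).comp (hx'.prodMk (hz'.prodMk hU))).snd
  have heq : {ω | E.pick tie t ω = (a, j)} =
      (fun ω => (act tie (x' ω) (fun b => E.Z b ω) (E.U ω) t).2) ⁻¹' {(a, j)} := by
    ext ω
    have h1 (b i : ℕ) (h : (b, i) ≠ (a, j)) : E.path ω b i = x' ω b i :=
      (if_neg h).symm
    exact ⟨act_eq_congr tie _ _ h1 t, act_eq_congr tie _ _ (fun b i h => (h1 b i h).symm) t⟩
  rw [heq]
  exact hm (measurableSet_singleton _)

theorem Env.measurable_pick
    (htie : ∀ t, Measurable (fun p : (ℕ → ℝ × ℝ) × S => tie t p.1 p.2))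
    (hκ : ∀ b, Measurable (E.κ b))
    (hX : ∀ b i k, Measurable (E.X b i k)) (hZ : ∀ b, Measurable (E.Z b))
    (hU : Measurable E.U) (t : ℕ) : Measurable (E.pick tie t) :=
  ((measurable_act htie t).comp ((measurable_pi_lambda _ fun b => measurable_pi_lambda _ fun i =>
    Env.measurable_path (hκ b) (hX b i)).prodMk ((measurable_pi_lambda _ hZ).prodMk hU))).snd

end SubAlgebra

section Model

variable {Ω S : Type*} [MeasurableSpace S]

/-- The information carried by a set of sources. -/
@[reducible] def Env.know (E : Env Ω S) (T : Set Source) : MeasurableSpace Ω := ⨆ i ∈ T, E.info i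

theorem Env.info_le_know (E : Env Ω S) {T : Set Source} {i : Source} (hi : i ∈ T) :
    E.info i ≤ E.know T := le_biSup E.info hi

theorem Env.know_mono (E : Env Ω S) {T T' : Set Source} (h : T ⊆ T') : E.know T ≤ E.know T' :=
  biSup_mono h

theorem Env.measurable_κ_know (E : Env Ω S) {T : Set Source} {a : ℕ} (h : Source.type a ∈ T) :
    Measurable[E.know T] (E.κ a) :=
  (comap_measurable (E.κ a)).mono (E.info_le_know h) le_rfl

theorem Env.measurable_X_know (E : Env Ω S) {T : Set Source} {a j : ℕ} {k : ArmType}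
    (h : Source.reward a j k ∈ T) : Measurable[E.know T] (E.X a j k) :=
  (comap_measurable (E.X a j k)).mono (E.info_le_know h) le_rfl

theorem Env.measurable_Z_know (E : Env Ω S) {T : Set Source} {a : ℕ} (h : Source.noise a ∈ T) :
    Measurable[E.know T] (E.Z a) :=
  (comap_measurable (E.Z a)).mono (E.info_le_know h) le_rfl

theorem Env.measurable_U_know (E : Env Ω S) {T : Set Source} (h : Source.seed ∈ T) :
    Measurable[E.know T] E.U :=
  (comap_measurable E.U).mono (E.info_le_know h) le_rfl

/-- The seed and the sources that belong to arms queried before time `a`. -/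
def pastSources (a : ℕ) : Set Source := fun s => match s with
  | .type b => b < a
  | .reward b _ _ => b < a
  | .noise b => b < a
  | .seed => True

/-- The types of the arms queried at times `a` and `a + 1`. -/
def typeSources (a : ℕ) : Set Source := fun s => match s with
  | .type b => b = a ∨ b = a + 1
  | _ => False

/-- The rewards and the perturbation of an epoch that starts at time `a`. -/
def rewardSources (a : ℕ) : Set Source := fun s => match s with
  | .reward b _ _ => b = a ∨ b = a + 1
  | .noise b => b = a
  | _ => False

theorem disjoint_past_type (a : ℕ) : Disjoint (pastSources a) (typeSources a) := by
  refine Set.disjoint_left.2 fun i h1 h2 => ?_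
  cases i
  · rename_i b
    have h1 : b < a := h1
    have h2 : b = a ∨ b = a + 1 := h2
    omega
  all_goals exact h2

theorem disjoint_past_union_type_reward (a : ℕ) :
    Disjoint (pastSources a ∪ typeSources a) (rewardSources a) := by
  refine Set.disjoint_left.2 fun i h1 h2 => ?_
  rcases h1 with h1 | h1
  · cases i
    · exact h2
    · rename_i b _ _
      have h1 : b < a := h1
      have h2 : b = a ∨ b = a + 1 := h2
      omega
    · rename_i b
      have h1 : b < a := h1
      have h2 : b = a := h2
      omega
    · exact h2
  · cases i
    · exact h2
    all_goals exact h1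

/-- The rewards and the perturbation of an epoch that starts at time `a`, for given types. -/
def Env.pairVars (E : Env Ω S) (a : ℕ) (k₁ k₂ : ArmType) : Option (Bool × ℕ) → Ω → ℝ
  | none => E.Z a
  | some (true, j) => E.X a j k₁
  | some (false, j) => E.X (a + 1) j k₂

theorem Env.measurable_pairVars (E : Env Ω S) (a : ℕ) (k₁ k₂ : ArmType) (i : Option (Bool × ℕ)) :
    Measurable[E.know (rewardSources a)] (E.pairVars a k₁ k₂ i) := by
  rcases i with _ | ⟨_ | _, j⟩
  · exact E.measurable_Z_know (show a = a from rfl)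
  · exact E.measurable_X_know (show _ ∨ _ from Or.inr rfl)
  · exact E.measurable_X_know (show _ ∨ _ from Or.inl rfl)

theorem Env.measurableSet_starts_past (E : Env Ω S) {tie : TieRule S}
    (htie : ∀ t, Measurable (fun p : (ℕ → ℝ × ℝ) × S => tie t p.1 p.2))
    (a : ℕ) :
    MeasurableSet[E.know (pastSources a)] (E.starts tie a) :=
  Env.measurableSet_starts (m := E.know (pastSources a)) htie
    (fun _ hb => E.measurable_κ_know hb) (fun _ hb _ _ => E.measurable_X_know hb)
    (fun _ hb => E.measurable_Z_know hb) (E.measurable_U_know trivial)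

theorem Env.measurableSet_types_know (E : Env Ω S) (a : ℕ) (k₁ k₂ : ArmType) :
    MeasurableSet[E.know (typeSources a)] (E.types a k₁ k₂) := by
  have h1 : MeasurableSet[E.know (typeSources a)] (E.κ a ⁻¹' {k₁}) :=
    E.measurable_κ_know (show _ ∨ _ from Or.inl rfl) trivial
  have h2 : MeasurableSet[E.know (typeSources a)] (E.κ (a + 1) ⁻¹' {k₂}) :=
    E.measurable_κ_know (show _ ∨ _ from Or.inr rfl) trivial
  exact MeasurableSet.inter h1 h2

variable [MeasurableSpace Ω] {E : Env Ω S} {α : ℕ → ℝ} {μ : ArmType → ℝ} {P : Measure Ω}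

theorem IsModel.info_le (hE : IsModel α μ P E) (i : Source) : E.info i ≤ ‹MeasurableSpace Ω› := by
  cases i
  · exact (hE.measurable_κ _).comap_le
  · exact (hE.measurable_X _ _ _).comap_le
  · exact (hE.measurable_Z _).comap_le
  · exact hE.measurable_U.comap_le

theorem IsModel.know_le (hE : IsModel α μ P E) (T : Set Source) :
    E.know T ≤ ‹MeasurableSpace Ω› := iSup₂_le fun i _ => hE.info_le i

theorem IsModel.indep_know (hE : IsModel α μ P E) {T T' : Set Source} (h : Disjoint T T') :
    Indep (E.know T) (E.know T') P :=
  indep_iSup_of_disjoint hE.info_le hE.indep h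

theorem IsModel.measureReal_inter (hE : IsModel α μ P E) {T T' : Set Source} (h : Disjoint T T')
    {A B : Set Ω} (hA : MeasurableSet[E.know T] A) (hB : MeasurableSet[E.know T'] B) :
    P.real (A ∩ B) = P.real A * P.real B := by
  simp only [measureReal_def, ← ENNReal.toReal_mul]
  rw [(Indep_iff _ _ _).1 (hE.indep_know h) A B hA hB]

/-- The types are fixed here, not random, so no conditioning is involved. The variables agree with
the observed rewards on `Env.types`. -/
theorem IsModel.pairModel (hE : IsModel α μ P E) (a : ℕ) (k₁ k₂ : ArmType) :
    PairModel P (E.pairVars a k₁ k₂) (fun b => bif b then μ k₁ else μ k₂) where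
  measurable i := by
    rcases i with _ | ⟨_ | _, j⟩
    · exact hE.measurable_Z _
    · exact hE.measurable_X _ _ _
    · exact hE.measurable_X _ _ _
  indep := by
    let g : Option (Bool × ℕ) → Source
      | none => .noise a
      | some (true, j) => .reward a j k₁
      | some (false, j) => .reward (a + 1) j k₂
    have hg : Function.Injective g := by
      rintro (_ | ⟨_ | _, j⟩) (_ | ⟨_ | _, j'⟩) h <;> simp_all [g]
    rw [iIndepFun_iff_iIndep]
    convert! hE.indep.precomp hg using 2 with i
    rcases i with _ | ⟨_ | _, j⟩ <;> rfl
  mem i := by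
    rcases i with ⟨_ | _, j⟩
    · exact hE.reward_mem _ _ _
    · exact hE.reward_mem _ _ _
  mean b j := by
    cases b
    · exact hE.reward_mean _ _ _
    · exact hE.reward_mean _ _ _
  law := hE.noise_law a

/-- The start of an epoch and the types of its arms are independent of its rewards. -/
theorem IsModel.measureReal_starts_types_inter (hE : IsModel α μ P E) {tie : TieRule S}
    (htie : ∀ t, Measurable (fun p : (ℕ → ℝ × ℝ) × S => tie t p.1 p.2))
    (a : ℕ) (k₁ k₂ : ArmType)
    {G : Set Ω} (hG : MeasurableSet[E.know (rewardSources a)] G) :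
    P.real ((E.starts tie a ∩ E.types a k₁ k₂) ∩ G) =
      P.real (E.starts tie a ∩ E.types a k₁ k₂) * P.real G :=
  hE.measureReal_inter (disjoint_past_union_type_reward a)
    (MeasurableSet.inter
      (E.know_mono Set.subset_union_left _ (E.measurableSet_starts_past htie a))
      (E.know_mono Set.subset_union_right _ (E.measurableSet_types_know a k₁ k₂))) hG

theorem IsModel.measureReal_starts_types (hE : IsModel α μ P E) {tie : TieRule S}
    (htie : ∀ t, Measurable (fun p : (ℕ → ℝ × ℝ) × S => tie t p.1 p.2))
    (a : ℕ)
    (k₁ k₂ : ArmType) :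
    P.real (E.starts tie a ∩ E.types a k₁ k₂) =
      P.real (E.starts tie a) * P.real (E.types a k₁ k₂) :=
  hE.measureReal_inter (disjoint_past_type a) (E.measurableSet_starts_past htie a)
    (E.measurableSet_types_know a k₁ k₂)

theorem IsModel.measureReal_types_optimal_inferior [IsProbabilityMeasure P] (hE : IsModel α μ P E)
    (hα : IsExogenous α) {a : ℕ} (ha : 1 ≤ a) :
    P.real (E.types a .optimal .inferior) = α a * (1 - α (a + 1)) := by
  have hreal (b : ℕ) (hb : 1 ≤ b) : P.real {ω | E.κ b ω = ArmType.optimal} = α b := by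
    rw [measureReal_def, hE.prob_optimal b hb, ENNReal.toReal_ofReal (hα.nonneg b hb)]
  have hinf : {ω | E.κ (a + 1) ω = ArmType.inferior} =
      {ω | E.κ (a + 1) ω = ArmType.optimal}ᶜ := by
    ext ω
    simp only [Set.mem_ofPred_eq, Set.mem_compl_iff]
    cases E.κ (a + 1) ω <;> simp
  have h1 : MeasurableSet[E.know {Source.type a}] {ω | E.κ a ω = ArmType.optimal} :=
    E.measurable_κ_know (Set.mem_singleton _) (t := {ArmType.optimal}) trivial
  have h2 : MeasurableSet[E.know {Source.type (a + 1)}]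
      {ω | E.κ (a + 1) ω = ArmType.inferior} :=
    E.measurable_κ_know (Set.mem_singleton _) (t := {ArmType.inferior}) trivial
  have h3 : MeasurableSet {ω | E.κ (a + 1) ω = ArmType.optimal} :=
    hE.measurable_κ (a + 1) (t := {ArmType.optimal}) trivial
  have h4 := hE.measureReal_inter (by simp) h1 h2
  rw [hinf, probReal_compl_eq_one_sub h3, hreal a ha, hreal (a + 1) (by omega), ← hinf] at h4
  exact h4

end Model

/-! ### The expected regret -/

section Pathwise

variable {Ω S : Type*}

/-- An inferior arm is played at time `t + 1`. -/
def Env.inferiorPlay (E : Env Ω S) (tie : TieRule S) (t : ℕ) : Set Ω :=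
  {ω | E.κ (E.pick tie t ω).1 ω = ArmType.inferior}

/-- Pull number `j` of arm `a`, which has type `k`, takes place at time `t + 1`. -/
def Env.pulls (E : Env Ω S) (tie : TieRule S) (t : ℕ) (p : ℕ × ℕ) (k : ArmType) : Set Ω :=
  {ω | E.pick tie t ω = p} ∩ {ω | E.κ p.1 ω = k}

theorem regret_eq (tie : TieRule S) (μ : ArmType → ℝ) (E : Env Ω S) (n : ℕ) (ω : Ω) :
    regret tie μ E n ω = ∑ t ∈ Finset.range n,
      (μ .optimal - E.path ω (E.pick tie t ω).1 (E.pick tie t ω).2) := by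
  induction n with
  | zero => simp [regret]
  | succ n ih =>
    rw [Finset.sum_range_succ, ← ih, regret, Finset.sum_Icc_succ_top (by omega), collected_succ]
    rfl

/-- The regret of one play is the gap on inferior plays minus the centred reward. The latter is
spread over all conceivable pulls, exactly one of which occurs, so that each summand pairs a fixed
reward with the event that it is collected. -/
theorem gap_eq (E : Env Ω S) (tie : TieRule S) (μ : ArmType → ℝ) (t : ℕ) (ω : Ω) :
    μ .optimal - E.path ω (E.pick tie t ω).1 (E.pick tie t ω).2 =
      (E.inferiorPlay tie t).indicator (fun _ => μ .optimal - μ .inferior) ω -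
        ∑ p ∈ Finset.range (t + 2) ×ˢ Finset.range (t + 1),
          ((E.pulls tie t p .optimal).indicator (fun ω => E.X p.1 p.2 .optimal ω - μ .optimal) ω +
          (E.pulls tie t p .inferior).indicator
            (fun ω => E.X p.1 p.2 .inferior ω - μ .inferior) ω) := by
  have h1 := act_label_le tie (E.path ω) (fun a => E.Z a ω) (E.U ω) t
  have h2 := act_pull_le tie (E.path ω) (fun a => E.Z a ω) (E.U ω) t
  rw [Finset.sum_eq_single (E.pick tie t ω)]
  · cases hk : E.κ (E.pick tie t ω).1 ω <;>
      simp [Set.indicator, Env.inferiorPlay, Env.pulls, Env.path, hk]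
  · intro p _ hp
    have h3 (k : ArmType) : ω ∉ E.pulls tie t p k := fun h => hp h.1.symm
    simp [h3]
  · intro h
    refine absurd ?_ h
    rw [Finset.mem_product, Finset.mem_range, Finset.mem_range]
    unfold Env.pick
    omega

variable [MeasurableSpace S]

theorem Env.measurableSet_pulls (E : Env Ω S) {tie : TieRule S}
    (htie : ∀ t, Measurable (fun p : (ℕ → ℝ × ℝ) × S => tie t p.1 p.2))
    (t : ℕ) (p : ℕ × ℕ) (k : ArmType) :
    MeasurableSet[E.know {Source.reward p.1 p.2 k}ᶜ] (E.pulls tie t p k) := by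
  refine MeasurableSet.inter ?_ ?_
  · exact Env.measurableSet_pick_eq (m := E.know {Source.reward p.1 p.2 k}ᶜ) htie t p.1 p.2
      (fun b => E.measurable_κ_know (by simp))
      (fun b i k' h => E.measurable_X_know fun h' => h (by cases h'; rfl))
      (fun b => E.measurable_Z_know (by simp))
      (E.measurable_U_know (by simp))
  · exact E.measurable_κ_know (by simp) (t := {k}) trivial

end Pathwise

theorem integral_indicator_mul_of_indep {Ω : Type*} {m₁ m₂ mΩ : MeasurableSpace Ω}
    {P : Measure Ω} [IsProbabilityMeasure P] (h : Indep m₁ m₂ P)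
    (hm₁ : m₁ ≤ mΩ) (hm₂ : m₂ ≤ mΩ) {A : Set Ω} 
    {f : Ω → ℝ}     (hA : MeasurableSet[m₁] A) (hf : Measurable[m₂] f) :
    ∫ ω, A.indicator f ω ∂P = P.real A * ∫ ω, f ω ∂P := by
  have hind : IndepFun (A.indicator (1 : Ω → ℝ)) f P := by
    rw [IndepFun_iff_Indep]
    refine indep_of_indep_of_le h ?_ hf.comap_le
    exact (Measurable.indicator (m := m₁) measurable_const hA).comap_le
  have h1 := hind.integral_fun_mul_eq_mul_integral
    (measurable_const.indicator (hm₁ _ hA)).aestronglyMeasurable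
    (Measurable.mono hf hm₂ le_rfl).aestronglyMeasurable
  rw [integral_indicator_one (hm₁ _ hA)] at h1
  rw [← h1]
  refine integral_congr_ae (ae_of_all _ fun ω => ?_)
  by_cases hω : ω ∈ A <;> simp [hω]

section Regret

variable {Ω S : Type*} [MeasurableSpace Ω] [MeasurableSpace S]

variable {E : Env Ω S} {α : ℕ → ℝ} {μ : ArmType → ℝ} {P : Measure Ω}
  {tie : TieRule S}

theorem IsModel.integrable_X [IsProbabilityMeasure P] (hE : IsModel α μ P E) (a j : ℕ) (k : ArmType) :
    Integrable (E.X a j k) P :=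
  Integrable.of_mem_Icc 0 1 (hE.measurable_X a j k).aemeasurable (hE.reward_mem a j k)

/-- The pull event is measurable with respect to all sources except the reward in question, hence
independent of that centred reward. -/
theorem IsModel.integral_pulls [IsProbabilityMeasure P]
    (htie : ∀ t, Measurable (fun p : (ℕ → ℝ × ℝ) × S => tie t p.1 p.2))
    (hE : IsModel α μ P E) (t : ℕ) (p : ℕ × ℕ) (k : ArmType) :
    Integrable ((E.pulls tie t p k).indicator fun ω => E.X p.1 p.2 k ω - μ k) P ∧
    ∫ ω, (E.pulls tie t p k).indicator (fun ω => E.X p.1 p.2 k ω - μ k) ω ∂P = 0 := by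
  have hA := E.measurableSet_pulls htie t p k
  refine ⟨((hE.integrable_X _ _ _).sub (integrable_const _)).indicator (hE.know_le _ _ hA), ?_⟩
  have h := integral_indicator_mul_of_indep (hE.indep_know (disjoint_compl_left
    (a := {Source.reward p.1 p.2 k}))) (hE.know_le _) (hE.know_le _) hA
    (f := fun ω => E.X p.1 p.2 k ω - μ k)
    ((E.measurable_X_know (Set.mem_singleton _)).sub_const _)
  rw [h, integral_sub (hE.integrable_X _ _ _) (integrable_const _), hE.reward_mean]
  simp

theorem IsModel.measurable_pick
    (htie : ∀ t, Measurable (fun p : (ℕ → ℝ × ℝ) × S => tie t p.1 p.2))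
    (hE : IsModel α μ P E) (t : ℕ) : Measurable (E.pick tie t) :=
  Env.measurable_pick htie hE.measurable_κ hE.measurable_X hE.measurable_Z hE.measurable_U t

theorem IsModel.measurableSet_inferiorPlay
    (htie : ∀ t, Measurable (fun p : (ℕ → ℝ × ℝ) × S => tie t p.1 p.2))
    (hE : IsModel α μ P E) (t : ℕ) :
    MeasurableSet (E.inferiorPlay tie t) := by
  have h : Measurable fun q : Ω × (ℕ × ℕ) => E.κ q.2.1 q.1 :=
    measurable_from_prod_countable_left fun q => hE.measurable_κ q.1
  exact (h.comp (measurable_id.prodMk (hE.measurable_pick htie t)))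
    (t := {ArmType.inferior}) trivial

theorem IsModel.integral_gap [IsProbabilityMeasure P]
    (htie : ∀ t, Measurable (fun p : (ℕ → ℝ × ℝ) × S => tie t p.1 p.2))
    (hE : IsModel α μ P E) (t : ℕ) :
    Integrable (fun ω => μ .optimal - E.path ω (E.pick tie t ω).1 (E.pick tie t ω).2) P ∧
    ∫ ω, (μ .optimal - E.path ω (E.pick tie t ω).1 (E.pick tie t ω).2) ∂P =
      (μ .optimal - μ .inferior) * P.real (E.inferiorPlay tie t) := by
  simp_rw [gap_eq]
  have hI : Integrable ((E.inferiorPlay tie t).indicator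
      fun _ => μ .optimal - μ .inferior) P :=
    (integrable_const _).indicator (hE.measurableSet_inferiorPlay htie t)
  have hp (p : ℕ × ℕ) (k : ArmType) := hE.integral_pulls htie t p k
  have hT (p : ℕ × ℕ) : Integrable (fun ω =>
      (E.pulls tie t p .optimal).indicator (fun ω => E.X p.1 p.2 .optimal ω - μ .optimal) ω +
      (E.pulls tie t p .inferior).indicator (fun ω => E.X p.1 p.2 .inferior ω - μ .inferior) ω)
      P := (hp p .optimal).1.add (hp p .inferior).1
  have hS := integrable_finsetSum (Finset.range (t + 2) ×ˢ Finset.range (t + 1)) fun p _ => hT p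
  refine ⟨hI.sub hS, ?_⟩
  rw [integral_sub hI hS, integral_finsetSum _ fun p _ => hT p,
    integral_indicator_const _ (hE.measurableSet_inferiorPlay htie t),
    Finset.sum_eq_zero, sub_zero, smul_eq_mul]
  · exact mul_comm _ _
  · intro p _
    rw [integral_add (hp p .optimal).1 (hp p .inferior).1, (hp p .optimal).2, (hp p .inferior).2,
      add_zero]

theorem IsModel.integrable_regret [IsProbabilityMeasure P]
    (htie : ∀ t, Measurable (fun p : (ℕ → ℝ × ℝ) × S => tie t p.1 p.2))
    (hE : IsModel α μ P E) (n : ℕ) :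
    Integrable (regret tie μ E n) P := by
  rw [show regret tie μ E n = _ from funext (regret_eq tie μ E n)]
  exact integrable_finsetSum _ fun t _ => (hE.integral_gap htie t).1

theorem IsModel.integral_regret [IsProbabilityMeasure P]
    (htie : ∀ t, Measurable (fun p : (ℕ → ℝ × ℝ) × S => tie t p.1 p.2))
    (hE : IsModel α μ P E) (n : ℕ) :
    ∫ ω, regret tie μ E n ω ∂P =
      (μ .optimal - μ .inferior) * ∑ t ∈ Finset.range n, P.real (E.inferiorPlay tie t) := by
  simp_rw [regret_eq]
  rw [integral_finsetSum _ fun t _ => (hE.integral_gap htie t).1, Finset.mul_sum]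
  exact Finset.sum_congr rfl fun t _ => (hE.integral_gap htie t).2

end Regret

/-! ### The number of inferior plays -/

section Deterministic

variable {S : Type*} (tie : TieRule S) (x : ℕ → ℕ → ℝ) (z : ℕ → ℝ) (u : S)

theorem act_label_eq {a t : ℕ} (h : (ep tie x z u (t + 1)).start = a) :
    (act tie x z u t).2.1 = a ∨ (act tie x z u t).2.1 = a + 1 := by
  rw [ep_succ] at h
  rcases act_cases tie x z u t _ rfl with ⟨h1, h'⟩ | ⟨h1, h2, h'⟩ | ⟨h1, h2, -, -, h'⟩ |
      ⟨h1, h2, -, -, h'⟩ <;> rw [h'] at h ⊢ <;> simp only at h ⊢ <;> omega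

/-- With `l ≥ 1` earlier pulls the play is not an opening one, so the index chose it; `t + 1 - a` is
the number of plays of the epoch before it. -/
theorem misjudges_fst {a t l : ℕ} (h : (ep tie x z u (t + 1)).start = a)
    (hp : (act tie x z u t).2.1 = a) (hl : 1 ≤ l) (hlp : l ≤ (act tie x z u t).2.2) :
    a ≤ t ∧ Misjudges (x (a + 1)) (x a) l (t + 1 - a) := by
  have hi := ep_invariant tie x z u t _ rfl
  rw [ep_succ] at h
  rcases act_cases tie x z u t _ rfl with ⟨h1, h'⟩ | ⟨h1, h2, h'⟩ | ⟨h1, h2, -, h3, h'⟩ |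
      ⟨h1, h2, -, -, h'⟩ <;> rw [h'] at h hp hlp <;> simp only at h hp hlp
  · omega
  · omega
  · rcases hi with ⟨-, hi⟩ | hi
    · rw [hi] at h1; exact absurd rfl h1
    · have hs : (ep tie x z u t).n₁ + (ep tie x z u t).n₂ = t + 1 - a := by omega
      rw [h, hs] at h3
      exact ⟨by omega, _, _, Nat.one_le_iff_ne_zero.2 h2, hlp, by omega, h3⟩
  · omega

theorem misjudges_snd {a t l : ℕ} (h : (ep tie x z u (t + 1)).start = a)
    (hp : (act tie x z u t).2.1 = a + 1) (hl : 1 ≤ l) (hlp : l ≤ (act tie x z u t).2.2) :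
    a ≤ t ∧ Misjudges (x a) (x (a + 1)) l (t + 1 - a) := by
  have hi := ep_invariant tie x z u t _ rfl
  rw [ep_succ] at h
  rcases act_cases tie x z u t _ rfl with ⟨h1, h'⟩ | ⟨h1, h2, h'⟩ | ⟨h1, h2, -, -, h'⟩ |
      ⟨h1, h2, -, h3, h'⟩ <;> rw [h'] at h hp hlp <;> simp only at h hp hlp
  · omega
  · omega
  · omega
  · rcases hi with ⟨-, hi⟩ | hi
    · rw [hi] at h1; exact absurd rfl h1
    · have hs : (ep tie x z u t).n₁ + (ep tie x z u t).n₂ = t + 1 - a := by omega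
      rw [h, hs] at h3
      exact ⟨by omega, _, _, Nat.one_le_iff_ne_zero.2 h1, hlp, by omega, h3⟩

end Deterministic

/-- The shift `c` is `1` for the length of the epoch after the play at time `t + 1`, and `0` for its
length before that play. -/
theorem sum_shift_le_tsum {f : ℕ → ℝ} (hf : Summable f) (h0 : ∀ s, 0 ≤ f s) (n c a : ℕ) :
    ∑ t ∈ Finset.range n with a ≤ t + c, f (t + c + 1 - a) ≤ ∑' s, f s := by
  rw [← Finset.sum_image (s := (Finset.range n).filter (a ≤ · + c))
    (g := fun t => t + c + 1 - a) (f := f)]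
  · exact hf.sum_le_tsum _ fun s _ => h0 s
  · intro t ht t' ht' h
    simp only [Finset.coe_filter, Set.mem_ofPred_eq] at ht ht' h
    omega

theorem summable_const_div_pow (c : ℝ) {p : ℕ} (hp : 1 < p) :
    Summable fun s : ℕ => c / (s : ℝ) ^ p := by
  have := (Real.summable_one_div_nat_pow.2 hp).mul_left c
  simpa only [mul_one_div] using this

/-- Bound on the expected length of an epoch with two inferior arms. -/
noncomputable def stayConst : ℝ := ∑' s : ℕ, 402 ^ 4 / (s : ℝ) ^ 2

/-- Bound on the expected number of misjudgements in an epoch. -/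
noncomputable def misjudgeConst : ℝ := ∑' s : ℕ, 2 / (s : ℝ) ^ 3

theorem stayConst_nonneg : 0 ≤ stayConst := tsum_nonneg fun _ => by positivity

theorem misjudgeConst_nonneg : 0 ≤ misjudgeConst := tsum_nonneg fun _ => by positivity

/-- The type of the first arm of an epoch whose optimal arm is the first one (`true`) or the second
one (`false`); applied to the negation it gives the type of the second arm. -/
def mixedType (c : Bool) : ArmType := bif c then .optimal else .inferior

section Model

variable {Ω S : Type*} {E : Env Ω S} {tie : TieRule S}

/-- The epoch that starts at time `a` is in force after the play at time `t + 1`. -/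
def Env.inEpoch (E : Env Ω S) (tie : TieRule S) (a t : ℕ) : Set Ω :=
  {ω | (E.epAt tie (t + 1) ω).start = a}

theorem Env.le_of_mem_inEpoch {a t : ℕ} {ω : Ω} (h : ω ∈ E.inEpoch tie a t) : a ≤ t + 1 :=
  (show (E.epAt tie (t + 1) ω).start = a from h) ▸ ep_start_le _ _ _ _ _

theorem Env.starts_of_mem_inEpoch {a t : ℕ} {ω : Ω} (h : ω ∈ E.inEpoch tie a t) :
    ω ∈ E.starts tie a :=
  ep_start_of_ep_start _ _ _ _ (Env.le_of_mem_inEpoch h) h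

theorem Env.path_of_mem_types {a : ℕ} {k₁ k₂ : ArmType} {ω : Ω} (h : ω ∈ E.types a k₁ k₂) :
    E.path ω a = (fun j => E.pairVars a k₁ k₂ (some (true, j)) ω) ∧
    E.path ω (a + 1) = (fun j => E.pairVars a k₁ k₂ (some (false, j)) ω) := by
  constructor <;> ext j
  · rw [Env.path, h.1]; rfl
  · rw [Env.path, h.2]; rfl

variable [MeasurableSpace Ω] [MeasurableSpace S] {α : ℕ → ℝ} {μ : ArmType → ℝ} {P : Measure Ω}

theorem IsModel.measurableSet_starts_types
    (htie : ∀ t, Measurable (fun p : (ℕ → ℝ × ℝ) × S => tie t p.1 p.2))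
    (hE : IsModel α μ P E) (a : ℕ) (k₁ k₂ : ArmType) :
    MeasurableSet (E.starts tie a ∩ E.types a k₁ k₂) :=
  (hE.know_le _ _ (E.measurableSet_starts_past htie a)).inter
    (hE.know_le _ _ (E.measurableSet_types_know a k₁ k₂))

variable [IsProbabilityMeasure P]

/-- The epoch of `a` is in force after time `t + 1` only if it has reached length `t + 2 - a`. The
necessary condition `LongStay` involves only the rewards and the perturbation of the epoch, so its
probability factors out and is summed over lengths. -/
theorem IsModel.sum_homogeneous_le
    (htie : ∀ t, Measurable (fun p : (ℕ → ℝ × ℝ) × S => tie t p.1 p.2))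
    (hE : IsModel α μ P E) (n a : ℕ) (k : ArmType) :
    ∑ t ∈ Finset.range n, P.real (E.inEpoch tie a t ∩ E.types a k k) ≤
      stayConst * P.real (E.starts tie a ∩ E.types a k k) := by
  have hpm := hE.pairModel a k k
  set G : ℕ → Set Ω := fun s => {ω | LongStay (fun j => E.pairVars a k k (some (true, j)) ω)
    (fun j => E.pairVars a k k (some (false, j)) ω) (E.pairVars a k k none ω) s}
  have hG (s : ℕ) : MeasurableSet[E.know (rewardSources a)] (G s) :=
    measurableSet_longStay (m := E.know (rewardSources a)) (fun _ => E.measurable_pairVars _ _ _ _)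
      (fun _ => E.measurable_pairVars _ _ _ _) (E.measurable_pairVars _ _ _ _) s
  have hterm (t : ℕ) (hat : a ≤ t + 1) : P.real (E.inEpoch tie a t ∩ E.types a k k) ≤
      P.real (E.starts tie a ∩ E.types a k k) * (402 ^ 4 / ((t + 1 + 1 - a : ℕ) : ℝ) ^ 2) := by
    calc _ ≤ P.real ((E.starts tie a ∩ E.types a k k) ∩ G (t + 1 + 1 - a)) := by
          refine measureReal_mono fun ω hω => ⟨⟨Env.starts_of_mem_inEpoch hω.1, hω.2⟩, ?_⟩
          have h1 := longStay_of_ep tie (E.path ω) (fun a => E.Z a ω) (E.U ω) (t + 1) _ rfl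
          have hst : (ep tie (E.path ω) (fun a => E.Z a ω) (E.U ω) (t + 1)).start = a := hω.1
          have hi := ep_invariant tie (E.path ω) (fun a => E.Z a ω) (E.U ω) (t + 1) _ rfl
          rw [hst, (Env.path_of_mem_types hω.2).1, (Env.path_of_mem_types hω.2).2,
            show (ep tie (E.path ω) (fun a => E.Z a ω) (E.U ω) (t + 1)).n₁ +
              (ep tie (E.path ω) (fun a => E.Z a ω) (E.U ω) (t + 1)).n₂ = t + 1 + 1 - a by
                omega] at h1
          exact h1
      _ = _ := hE.measureReal_starts_types_inter htie a k k (hG _)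
      _ ≤ _ := by
          gcongr
          exact hpm.measureReal_longStay_le (by simp) (by omega)
  calc _ = ∑ t ∈ Finset.range n with a ≤ t + 1, P.real (E.inEpoch tie a t ∩ E.types a k k) := by
        refine (Finset.sum_filter_of_ne fun t _ h => ?_).symm
        by_contra hlt
        refine h ?_
        rw [show E.inEpoch tie a t ∩ E.types a k k = ∅ from
          Set.eq_empty_of_forall_notMem fun ω hω => hlt (Env.le_of_mem_inEpoch hω.1)]
        simp
    _ ≤ ∑ t ∈ Finset.range n with a ≤ t + 1, P.real (E.starts tie a ∩ E.types a k k) *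
          (402 ^ 4 / ((t + 1 + 1 - a : ℕ) : ℝ) ^ 2) :=
        Finset.sum_le_sum fun t ht => hterm t (Finset.mem_filter.1 ht).2
    _ ≤ _ := by
        rw [← Finset.mul_sum, mul_comm]
        gcongr
        exact sum_shift_le_tsum (f := fun s : ℕ => 402 ^ 4 / (s : ℝ) ^ 2)
          (summable_const_div_pow _ (by norm_num)) (fun s => by positivity) n 1 a

/-- For each `j < l` the events that pull `j` of arm `b` happens at time `t + 1` are disjoint in
`t`. -/
theorem IsModel.sum_measureReal_pick_le
    (htie : ∀ t, Measurable (fun p : (ℕ → ℝ × ℝ) × S => tie t p.1 p.2))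
    (hE : IsModel α μ P E) {B : Set Ω} (hB : MeasurableSet B)
    (n b l : ℕ) : ∑ t ∈ Finset.range n,
      P.real (B ∩ {ω | (E.pick tie t ω).1 = b ∧ (E.pick tie t ω).2 < l}) ≤ l * P.real B := by
  have hm (t j : ℕ) : MeasurableSet (B ∩ {ω | E.pick tie t ω = (b, j)}) :=
    hB.inter (hE.measurable_pick htie t (measurableSet_singleton (b, j)))
  calc _ ≤ ∑ t ∈ Finset.range n, ∑ j ∈ Finset.range l,
          P.real (B ∩ {ω | E.pick tie t ω = (b, j)}) := by
        refine Finset.sum_le_sum fun t _ => ?_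
        refine le_trans (measureReal_mono (fun ω hω => ?_) (measure_ne_top _ _))
          (measureReal_biUnion_finset_le _ _)
        simp only [Set.mem_iUnion, Finset.mem_range]
        exact ⟨_, hω.2.2, hω.1, Prod.ext hω.2.1 rfl⟩
    _ = ∑ j ∈ Finset.range l, ∑ t ∈ Finset.range n,
          P.real (B ∩ {ω | E.pick tie t ω = (b, j)}) := Finset.sum_comm
    _ ≤ ∑ j ∈ Finset.range l, P.real B := by
        refine Finset.sum_le_sum fun j _ => ?_
        rw [← measureReal_biUnion_finset (fun t _ t' _ htt => ?_) (fun t _ => hm t j)]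
        · exact measureReal_mono (Set.iUnion₂_subset fun t _ => Set.inter_subset_left)
        · refine Set.disjoint_left.2 fun ω h1 h2 => htt ?_
          exact act_injective tie (E.path ω) (fun a => E.Z a ω) (E.U ω) (h1.2.trans h2.2.symm)
    _ = l * P.real B := by simp

/-- The first `l` pulls of the inferior arm are counted in full; every later one is a misjudgement,
whose probability is summable in the length of the epoch and independent of its start and types. -/
theorem IsModel.sum_mixed_le
    (htie : ∀ t, Measurable (fun p : (ℕ → ℝ × ℝ) × S => tie t p.1 p.2))
    (hE : IsModel α μ P E) {Δ : ℝ}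
    (hΔ : Δ = μ .optimal - μ .inferior) (h0 : 0 < Δ) (n a l : ℕ) (hl : 1 ≤ l)
    (hln : 8 * Real.log n ≤ Δ ^ 2 * l) (c : Bool) :
    ∑ t ∈ Finset.range n, P.real (E.inEpoch tie a t ∩ E.inferiorPlay tie t ∩
      E.types a (mixedType c) (mixedType !c)) ≤
      (l + misjudgeConst) * P.real (E.starts tie a ∩ E.types a (mixedType c) (mixedType !c)) := by
  have hpm := hE.pairModel a (mixedType c) (mixedType !c)
  set V := E.pairVars a (mixedType c) (mixedType !c) with hV
  set B := E.starts tie a ∩ E.types a (mixedType c) (mixedType !c) with hB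
  have hBm : MeasurableSet B := hE.measurableSet_starts_types htie _ _ _
  -- `b` is the label of the inferior arm: the second arm exactly when the first is optimal.
  set b : ℕ := bif c then a + 1 else a with hb
  set G : ℕ → Set Ω := fun s =>
    {ω | Misjudges (fun j => V (some (c, j)) ω) (fun j => V (some (!c, j)) ω) l s}
  have hG (s : ℕ) : MeasurableSet[E.know (rewardSources a)] (G s) :=
    measurableSet_misjudges (m := E.know (rewardSources a)) (fun _ => E.measurable_pairVars _ _ _ _)
      (fun _ => E.measurable_pairVars _ _ _ _) l s
  have hPG (s : ℕ) (hs : 1 ≤ s) (hsn : s ≤ n) : P.real (G s) ≤ 2 / (s : ℝ) ^ 3 := by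
    refine hpm.measureReal_misjudges_le (b := c) (Δ := Δ) ?_ h0 hl hs (le_trans ?_ hln)
    · cases c <;> simp [mixedType, hΔ]
    · have : Real.log s ≤ Real.log n :=
        Real.log_le_log (by exact_mod_cast hs) (by exact_mod_cast hsn)
      linarith
  have hcover (t : ℕ) : E.inEpoch tie a t ∩ E.inferiorPlay tie t ∩
      E.types a (mixedType c) (mixedType !c) ⊆
      (B ∩ {ω | (E.pick tie t ω).1 = b ∧ (E.pick tie t ω).2 < l}) ∪
        {ω | a ≤ t ∧ ω ∈ B ∩ G (t + 1 - a)} := by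
    rintro ω ⟨⟨h1, h2⟩, h3⟩
    have hBω : ω ∈ B := ⟨Env.starts_of_mem_inEpoch h1, h3⟩
    have hlab : (E.pick tie t ω).1 = a ∨ (E.pick tie t ω).1 = a + 1 := act_label_eq _ _ _ _ h1
    have hbl : (E.pick tie t ω).1 = b := by
      have h2' : E.κ (E.pick tie t ω).1 ω = ArmType.inferior := h2
      rcases hlab with h | h <;> rw [h] at h2' ⊢ <;> cases c
      · rfl
      · exact absurd (h3.1.symm.trans h2') (by simp [mixedType])
      · exact absurd (h3.2.symm.trans h2') (by simp [mixedType])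
      · rfl
    rcases lt_or_ge (E.pick tie t ω).2 l with hlt | hge
    · exact Or.inl ⟨hBω, hbl, hlt⟩
    · right
      obtain ⟨hp1, hp2⟩ := Env.path_of_mem_types h3
      cases c
      · obtain ⟨hat, hmis⟩ := misjudges_fst _ _ _ _ h1 hbl hl hge
        rw [hp1, hp2] at hmis
        exact ⟨hat, hBω, hmis⟩
      · obtain ⟨hat, hmis⟩ := misjudges_snd _ _ _ _ h1 hbl hl hge
        rw [hp1, hp2] at hmis
        exact ⟨hat, hBω, hmis⟩
  calc _ ≤ ∑ t ∈ Finset.range n,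
        (P.real (B ∩ {ω | (E.pick tie t ω).1 = b ∧ (E.pick tie t ω).2 < l}) +
          P.real {ω | a ≤ t ∧ ω ∈ B ∩ G (t + 1 - a)}) :=
        Finset.sum_le_sum fun t _ =>
          (measureReal_mono (hcover t) (measure_ne_top _ _)).trans (measureReal_union_le _ _)
    _ = ∑ t ∈ Finset.range n,
          P.real (B ∩ {ω | (E.pick tie t ω).1 = b ∧ (E.pick tie t ω).2 < l}) +
        ∑ t ∈ Finset.range n, P.real {ω | a ≤ t ∧ ω ∈ B ∩ G (t + 1 - a)} :=
        Finset.sum_add_distrib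
    _ ≤ l * P.real B + misjudgeConst * P.real B := by
        refine add_le_add (hE.sum_measureReal_pick_le htie hBm n b l) ?_
        calc _ = ∑ t ∈ Finset.range n with a ≤ t + 0,
              P.real {ω | a ≤ t ∧ ω ∈ B ∩ G (t + 1 - a)} := by
              refine (Finset.sum_filter_of_ne fun t _ h => ?_).symm
              by_contra hlt
              refine h ?_
              rw [show {ω | a ≤ t ∧ ω ∈ B ∩ G (t + 1 - a)} = ∅ from
                Set.eq_empty_of_forall_notMem fun ω hω => hlt hω.1]
              simp
          _ ≤ ∑ t ∈ Finset.range n with a ≤ t + 0,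
              P.real B * (2 / ((t + 0 + 1 - a : ℕ) : ℝ) ^ 3) := by
              refine Finset.sum_le_sum fun t ht => ?_
              rw [Finset.mem_filter, Finset.mem_range] at ht
              calc _ ≤ P.real (B ∩ G (t + 1 - a)) :=
                    measureReal_mono (fun ω hω => hω.2) (measure_ne_top _ _)
                _ = P.real B * P.real (G (t + 1 - a)) :=
                    hE.measureReal_starts_types_inter htie a _ _ (hG _)
                _ ≤ _ := by
                    gcongr
                    exact hPG _ (by omega) (by omega)
          _ ≤ _ := by
              rw [← Finset.mul_sum, mul_comm]
              gcongr
              exact sum_shift_le_tsum (f := fun s : ℕ => 2 / (s : ℝ) ^ 3)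
                (summable_const_div_pow _ (by norm_num)) (fun s => by positivity) n 0 a
    _ = _ := by ring

/-- The probability that an epoch with two arms of different types starts at time `a`. -/
noncomputable def mixedProb (P : Measure Ω) (E : Env Ω S) (tie : TieRule S) (a : ℕ) : ℝ :=
  P.real (E.starts tie a ∩ E.types a (mixedType true) (mixedType !true)) +
    P.real (E.starts tie a ∩ E.types a (mixedType false) (mixedType !false))

/-- The epoch containing an inferior play starts in `[1, n]` and cannot have two optimal arms. When
both arms are inferior, all plays of the epoch are counted. -/
theorem IsModel.sum_inferiorPlay_le
    (htie : ∀ t, Measurable (fun p : (ℕ → ℝ × ℝ) × S => tie t p.1 p.2))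
    (hE : IsModel α μ P E) {Δ : ℝ}
    (hΔ : Δ = μ .optimal - μ .inferior) (h0 : 0 < Δ) (n l : ℕ) (hl : 1 ≤ l)
    (hln : 8 * Real.log n ≤ Δ ^ 2 * l) :
    ∑ t ∈ Finset.range n, P.real (E.inferiorPlay tie t) ≤
      stayConst * ∑ a ∈ Finset.Icc 1 n, P.real (E.starts tie a) +
      (l + misjudgeConst) * ∑ a ∈ Finset.Icc 1 n, mixedProb P E tie a := by
  set H : ℕ → ℕ → Set Ω := fun a t =>
    E.inEpoch tie a t ∩ E.types a ArmType.inferior ArmType.inferior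
  set M : Bool → ℕ → ℕ → Set Ω := fun c a t => E.inEpoch tie a t ∩ E.inferiorPlay tie t ∩
    E.types a (mixedType c) (mixedType !c)
  have hcover (t : ℕ) (ht : t < n) : E.inferiorPlay tie t ⊆
      ⋃ a ∈ Finset.Icc 1 n, (H a t ∪ (M true a t ∪ M false a t)) := by
    intro ω hω
    have h1 := ep_start_le tie (E.path ω) (fun a => E.Z a ω) (E.U ω) (t + 1)
    have h2 := one_le_ep_start tie (E.path ω) (fun a => E.Z a ω) (E.U ω) (show 1 ≤ t + 1 by omega)
    have hlab : (E.pick tie t ω).1 = _ ∨ (E.pick tie t ω).1 = _ + 1 := act_label_eq _ _ _ _ rfl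
    simp only [Set.mem_iUnion, Finset.mem_Icc]
    refine ⟨_, ⟨h2, h1.trans ht⟩, ?_⟩
    set a := (ep tie (E.path ω) (fun a => E.Z a ω) (E.U ω) (t + 1)).start with ha
    have hin : ω ∈ E.inEpoch tie a t := rfl
    have hω' : E.κ (E.pick tie t ω).1 ω = ArmType.inferior := hω
    cases hk1 : E.κ a ω <;> cases hk2 : E.κ (a + 1) ω
    · rcases hlab with h | h <;> rw [h] at hω'
      · exact absurd (hk1.symm.trans hω') (by simp)
      · exact absurd (hk2.symm.trans hω') (by simp)
    · exact Or.inr (Or.inl ⟨⟨hin, hω⟩, hk1, hk2⟩)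
    · exact Or.inr (Or.inr ⟨⟨hin, hω⟩, hk1, hk2⟩)
    · exact Or.inl ⟨hin, hk1, hk2⟩
  calc _ ≤ ∑ t ∈ Finset.range n, ∑ a ∈ Finset.Icc 1 n,
        (P.real (H a t) + (P.real (M true a t) + P.real (M false a t))) := by
        refine Finset.sum_le_sum fun t ht => ?_
        refine (measureReal_mono (hcover t (Finset.mem_range.1 ht)) (measure_ne_top _ _)).trans
          ((measureReal_biUnion_finset_le _ _).trans (Finset.sum_le_sum fun a _ => ?_))
        refine (measureReal_union_le _ _).trans ?_
        gcongr
        exact measureReal_union_le _ _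
    _ = ∑ a ∈ Finset.Icc 1 n, (∑ t ∈ Finset.range n, P.real (H a t) +
          (∑ t ∈ Finset.range n, P.real (M true a t) +
            ∑ t ∈ Finset.range n, P.real (M false a t))) := by
        rw [Finset.sum_comm]
        simp only [Finset.sum_add_distrib]
    _ ≤ ∑ a ∈ Finset.Icc 1 n, (stayConst * P.real (E.starts tie a) +
          (l + misjudgeConst) * mixedProb P E tie a) := by
        refine Finset.sum_le_sum fun a ha => ?_
        rw [Finset.mem_Icc] at ha
        rw [mixedProb, mul_add]
        refine add_le_add ((hE.sum_homogeneous_le htie n a _).trans ?_)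
          (add_le_add (hE.sum_mixed_le htie hΔ h0 n a l hl hln true)
            (hE.sum_mixed_le htie hΔ h0 n a l hl hln false))
        exact mul_le_mul_of_nonneg_left (measureReal_mono Set.inter_subset_left) stayConst_nonneg
    _ = _ := by rw [Finset.sum_add_distrib, Finset.mul_sum, Finset.mul_sum]

end Model

/-! ### The number of epochs, and the regret bound -/

section Model

variable {Ω S : Type*} {E : Env Ω S} {tie : TieRule S}

/-- An epoch with arms of different types starts at time `a` and passes all tests. -/
def Env.lasting (E : Env Ω S) (tie : TieRule S) (a : ℕ) (c : Bool) : Set Ω :=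
  (E.starts tie a ∩ E.types a (mixedType c) (mixedType !c)) ∩
    {ω | ∀ m, 1 ≤ m → Passes (fun j => E.pairVars a (mixedType c) (mixedType !c) (some (true, j)) ω)
      (fun j => E.pairVars a (mixedType c) (mixedType !c) (some (false, j)) ω)
      (E.pairVars a (mixedType c) (mixedType !c) none ω) m}

theorem Env.inEpoch_of_lasting {a b : ℕ} (ha : 1 ≤ a) (hab : a ≤ b) {c : Bool} {ω : Ω}
    (h : ω ∈ E.lasting tie a c) : (E.epAt tie b ω).start = a := by
  obtain ⟨⟨h1, h2⟩, h3⟩ := h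
  refine ep_start_eq_of_passes tie (E.path ω) (fun a => E.Z a ω) (E.U ω) ha h1 ?_ hab
  rw [(Env.path_of_mem_types h2).1, (Env.path_of_mem_types h2).2]
  exact h3

variable [MeasurableSpace Ω] [MeasurableSpace S] {α : ℕ → ℝ} {μ : ArmType → ℝ} {P : Measure Ω}
  [IsProbabilityMeasure P]

theorem IsModel.mean_mem_Icc (hE : IsModel α μ P E) (k : ArmType) : μ k ∈ Set.Icc (0 : ℝ) 1 := by
  have h := hE.reward_mem 0 0 k
  rw [← hE.reward_mean 0 0 k]
  refine ⟨integral_nonneg_of_ae (h.mono fun ω hω => hω.1), ?_⟩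
  have := integral_mono_ae (hE.integrable_X 0 0 k) (integrable_const (1 : ℝ))
    (h.mono fun ω hω => hω.2)
  simpa using this

theorem IsModel.gap_le_one (hE : IsModel α μ P E) : μ .optimal - μ .inferior ≤ 1 := by
  linarith [(hE.mean_mem_Icc .optimal).2, (hE.mean_mem_Icc .inferior).1]

/-- By independence a mixed epoch lasts forever with conditional probability at least `beta Δ`.
Lasting epochs exclude each other, so their probabilities add up to at most one. -/
theorem IsModel.sum_mixedProb_le
    (htie : ∀ t, Measurable (fun p : (ℕ → ℝ × ℝ) × S => tie t p.1 p.2))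
    (hE : IsModel α μ P E) {Δ : ℝ}
    (hΔ : Δ = μ .optimal - μ .inferior) (h0 : 0 < Δ) (n : ℕ) :
    beta Δ * ∑ a ∈ Finset.Icc 1 n, mixedProb P E tie a ≤ 1 := by
  have hGm (a : ℕ) (c : Bool) := measurableSet_forall_passes (m := E.know (rewardSources a))
    (fun j => E.measurable_pairVars a (mixedType c) (mixedType !c) (some (true, j)))
    (fun j => E.measurable_pairVars a (mixedType c) (mixedType !c) (some (false, j)))
    (E.measurable_pairVars a (mixedType c) (mixedType !c) none)
  have hm (a : ℕ) (c : Bool) : MeasurableSet (E.lasting tie a c) :=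
    (hE.measurableSet_starts_types htie a _ _).inter (hE.know_le _ _ (hGm a c))
  have hle (a : ℕ) (c : Bool) :
      beta Δ * P.real (E.starts tie a ∩ E.types a (mixedType c) (mixedType !c)) ≤
        P.real (E.lasting tie a c) := by
    rw [Env.lasting, hE.measureReal_starts_types_inter htie a _ _ (hGm a c), mul_comm]
    refine mul_le_mul_of_nonneg_left ?_ measureReal_nonneg
    refine (hE.pairModel a (mixedType c) (mixedType !c)).beta_le_passes ?_ h0
      (hΔ ▸ hE.gap_le_one)
    cases c
    · simp only [mixedType, cond_true, cond_false, Bool.not_false]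
      rw [abs_sub_comm, ← hΔ, abs_of_pos h0]
    · simp only [mixedType, cond_true, cond_false, Bool.not_true]
      rw [← hΔ, abs_of_pos h0]
  have hdisj (a : ℕ) : Disjoint (E.lasting tie a true) (E.lasting tie a false) := by
    refine Set.disjoint_left.2 fun ω h1 h2 => ?_
    exact absurd (h1.1.2.1.symm.trans h2.1.2.1) (by simp [mixedType])
  calc _ = ∑ a ∈ Finset.Icc 1 n, beta Δ * mixedProb P E tie a := Finset.mul_sum _ _ _
    _ ≤ ∑ a ∈ Finset.Icc 1 n, P.real (E.lasting tie a true ∪ E.lasting tie a false) := by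
        refine Finset.sum_le_sum fun a _ => ?_
        rw [measureReal_union (hdisj a) (hm a false), mixedProb, mul_add]
        exact add_le_add (hle a true) (hle a false)
    _ = P.real (⋃ a ∈ Finset.Icc 1 n, (E.lasting tie a true ∪ E.lasting tie a false)) := by
        refine (measureReal_biUnion_finset (fun a ha b hb hab => ?_)
          (fun a _ => (hm a true).union (hm a false))).symm
        have hstart {a : ℕ} (ha : a ∈ (Finset.Icc 1 n : Finset ℕ)) {ω : Ω}
            (h : ω ∈ E.lasting tie a true ∪ E.lasting tie a false) {b : ℕ} (hab : a ≤ b) :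
            (E.epAt tie b ω).start = a := by
          have ha1 := (Finset.mem_Icc.1 ha).1
          rcases h with h | h
          · exact Env.inEpoch_of_lasting ha1 hab h
          · exact Env.inEpoch_of_lasting ha1 hab h
        -- At time `max a b` both epochs would have to be in force.
        refine Set.disjoint_left.2 fun ω h1 h2 => hab ?_
        exact (hstart ha h1 (le_max_left a b)).symm.trans (hstart hb h2 (le_max_right a b))
    _ ≤ 1 := measureReal_le_one

/-- A new epoch has types (optimal, inferior) with probability `α(a) (1 - α(a + 1)) ≥ α(n) (1 -
α(1))`, independently of its start. This single orientation suffices to compare all epochs with the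
mixed ones. -/
theorem IsModel.sum_starts_le
    (htie : ∀ t, Measurable (fun p : (ℕ → ℝ × ℝ) × S => tie t p.1 p.2))
    (hE : IsModel α μ P E) (hα : IsExogenous α) {Δ : ℝ}
    (hΔ : Δ = μ .optimal - μ .inferior) (h0 : 0 < Δ) (n : ℕ) :
    α n * ∑ a ∈ Finset.Icc 1 n, P.real (E.starts tie a) ≤ 1 / ((1 - α 1) * beta Δ) := by
  have hα1 : 0 < 1 - α 1 := sub_pos.2 hα.one_lt_one
  rw [le_div_iff₀ (mul_pos hα1 (beta_pos Δ))]
  refine le_trans ?_ (hE.sum_mixedProb_le htie hΔ h0 n)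
  rw [show α n * (∑ a ∈ Finset.Icc 1 n, P.real (E.starts tie a)) * ((1 - α 1) * beta Δ) =
    beta Δ * ((∑ a ∈ Finset.Icc 1 n, P.real (E.starts tie a)) * ((1 - α 1) * α n)) by ring]
  refine mul_le_mul_of_nonneg_left ?_ (beta_pos Δ).le
  rw [Finset.sum_mul]
  refine Finset.sum_le_sum fun a ha => ?_
  obtain ⟨ha1, han⟩ := Finset.mem_Icc.1 ha
  have h1 := hE.measureReal_starts_types htie a .optimal .inferior
  rw [hE.measureReal_types_optimal_inferior hα ha1] at h1
  calc P.real (E.starts tie a) * ((1 - α 1) * α n)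
      ≤ P.real (E.starts tie a) * (α a * (1 - α (a + 1))) := by
        refine mul_le_mul_of_nonneg_left ?_ measureReal_nonneg
        rw [mul_comm]
        refine mul_le_mul (hα.anti a n ha1 han) ?_ hα1.le (hα.nonneg a ha1)
        linarith [hα.anti 1 (a + 1) le_rfl (by omega)]
    _ = _ := h1.symm
    _ ≤ mixedProb P E tie a := le_add_of_nonneg_right measureReal_nonneg

theorem IsModel.integral_regret_nonneg
    (htie : ∀ t, Measurable (fun p : (ℕ → ℝ × ℝ) × S => tie t p.1 p.2))
    (hE : IsModel α μ P E)
    (h0 : 0 < μ .optimal - μ .inferior) (n : ℕ) : 0 ≤ ∫ ω, regret tie μ E n ω ∂P := by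
  rw [hE.integral_regret htie]
  exact mul_nonneg h0.le (Finset.sum_nonneg fun _ _ => measureReal_nonneg)

/-- The factor `α n` is kept because the number of epochs is controlled only after multiplication by
it; the logarithm comes from the mixed epochs alone. -/
theorem IsModel.exists_regret_le
    (htie : ∀ t, Measurable (fun p : (ℕ → ℝ × ℝ) × S => tie t p.1 p.2))
    (hE : IsModel α μ P E) (hα : IsExogenous α) {Δ : ℝ}
    (hΔ : Δ = μ .optimal - μ .inferior) (h0 : 0 < Δ) :
    ∃ C, 0 ≤ C ∧ ∀ n, 1 ≤ n → α n * ∫ ω, regret tie μ E n ω ∂P ≤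
      α n * (8 / (Δ * beta Δ) * Real.log n) + C := by
  have hα1 : 0 < 1 - α 1 := sub_pos.2 hα.one_lt_one
  have hβ := beta_pos Δ
  have hs := stayConst_nonneg
  have hm := misjudgeConst_nonneg
  refine ⟨Δ * (stayConst * (1 / ((1 - α 1) * beta Δ)) + (2 + misjudgeConst) / beta Δ),
    by positivity, fun n hn => ?_⟩
  have hlog : 0 ≤ Real.log n := Real.log_nonneg (by exact_mod_cast hn)
  have hαn := hα.nonneg n hn
  have hαn1 : α n ≤ 1 := (hα.anti 1 n le_rfl hn).trans hα.one_lt_one.le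
  -- The extra `1` keeps `l ≥ 1` when `n = 1`; it only affects the constant.
  set l : ℕ := ⌈8 * Real.log n / Δ ^ 2⌉₊ + 1 with hl
  have hl1 : 8 * Real.log n ≤ Δ ^ 2 * l := by
    have := Nat.le_ceil (8 * Real.log n / Δ ^ 2)
    rw [div_le_iff₀ (by positivity)] at this
    rw [hl]
    push_cast
    nlinarith [sq_nonneg Δ]
  have hl2 : (l : ℝ) ≤ 8 * Real.log n / Δ ^ 2 + 2 := by
    have := Nat.ceil_lt_add_one (show 0 ≤ 8 * Real.log n / Δ ^ 2 by positivity)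
    rw [hl]
    push_cast
    linarith
  have hmix0 : 0 ≤ ∑ a ∈ Finset.Icc 1 n, mixedProb P E tie a :=
    Finset.sum_nonneg fun a _ => add_nonneg measureReal_nonneg measureReal_nonneg
  have hmix : ∑ a ∈ Finset.Icc 1 n, mixedProb P E tie a ≤ 1 / beta Δ := by
    rw [le_div_iff₀ hβ, mul_comm]
    exact hE.sum_mixedProb_le htie hΔ h0 n
  have hstart := hE.sum_starts_le htie hα hΔ h0 n
  have hsum := hE.sum_inferiorPlay_le htie hΔ h0 n l (by omega) hl1
  rw [hE.integral_regret htie, ← hΔ]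
  calc α n * (Δ * ∑ t ∈ Finset.range n, P.real (E.inferiorPlay tie t))
      ≤ α n * (Δ * (stayConst * ∑ a ∈ Finset.Icc 1 n, P.real (E.starts tie a) +
          (l + misjudgeConst) * ∑ a ∈ Finset.Icc 1 n, mixedProb P E tie a)) := by gcongr
    _ = Δ * (stayConst * (α n * ∑ a ∈ Finset.Icc 1 n, P.real (E.starts tie a)) +
          α n * ((l + misjudgeConst) * ∑ a ∈ Finset.Icc 1 n, mixedProb P E tie a)) := by ring
    _ ≤ Δ * (stayConst * (1 / ((1 - α 1) * beta Δ)) +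
          α n * ((8 * Real.log n / Δ ^ 2 + 2 + misjudgeConst) * (1 / beta Δ))) := by gcongr
    _ = α n * (8 / (Δ * beta Δ) * Real.log n) +
          Δ * (stayConst * (1 / ((1 - α 1) * beta Δ)) +
            α n * ((2 + misjudgeConst) / beta Δ)) := by
        field_simp
        ring
    _ ≤ _ := by
        gcongr
        exact mul_le_of_le_one_left (by positivity) hαn1

end Model

/-! ### Limits -/

theorem limsup_le_of_forall_le_add {α r : ℕ → ℝ} {K C : ℝ} (hK : 0 ≤ K)
    (hα : ∀ n, 1 ≤ n → α n ≤ 1)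
    (h : ∀ n, 1 ≤ n → α n * r n ≤ α n * (K * Real.log n) + C) :
    limsup (fun n : ℕ => ((α n * r n / Real.log n : ℝ) : EReal)) atTop ≤ (K : EReal) := by
  have hlim : Tendsto (fun n : ℕ => ((K + C / Real.log n : ℝ) : EReal)) atTop
      (nhds (K : EReal)) := by
    refine (continuous_coe_real_ereal.tendsto K).comp ?_
    have h1 : Tendsto (fun n : ℕ => Real.log n) atTop atTop :=
      Real.tendsto_log_atTop.comp tendsto_natCast_atTop_atTop
    simpa using (h1.const_div_atTop C).const_add K
  rw [← hlim.limsup_eq]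
  refine limsup_le_limsup ?_
  filter_upwards [eventually_ge_atTop 2] with n hn
  have hlog : 0 < Real.log n := Real.log_pos (by exact_mod_cast hn)
  refine EReal.coe_le_coe_iff.2 ?_
  rw [div_le_iff₀ hlog, add_mul, div_mul_cancel₀ _ hlog.ne']
  refine (h n (by omega)).trans ?_
  have := mul_le_of_le_one_left (mul_nonneg hK hlog.le) (hα n (by omega))
  linarith

theorem isLittleO_of_forall_le_add {α r : ℕ → ℝ} {K C : ℝ} (hC : 0 ≤ C)
    (hα : ∀ n, 1 ≤ n → 0 ≤ α n) (hr : ∀ n, 0 ≤ r n)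
    (h : ∀ n, 1 ≤ n → α n * r n ≤ α n * (K * Real.log n) + C)
    (ho : (fun n : ℕ => Real.log n / n) =o[atTop] α) :
    r =o[atTop] (fun n : ℕ => (n : ℝ)) := by
  have hlog : (fun n : ℕ => K * Real.log n) =o[atTop] fun n : ℕ => (n : ℝ) :=
    (Real.isLittleO_log_id_atTop.comp_tendsto tendsto_natCast_atTop_atTop).const_mul_left K
  rw [isLittleO_iff]
  intro c hc
  -- This choice makes `C ≤ α n * (c / 2 * n)` as soon as `log n ≥ 1`, which explains `n ≥ 3`. The
  -- other half of `c` absorbs `K log n`.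
  have hε : 0 < c / 2 / (C + 1) := by positivity
  filter_upwards [isLittleO_iff.1 ho hε, isLittleO_iff.1 hlog (half_pos hc),
    eventually_ge_atTop 3] with n h1 h2 hn
  have hn0 : (3 : ℝ) ≤ n := by exact_mod_cast hn
  have hlog1 : 1 ≤ Real.log n := by
    rw [Real.le_log_iff_exp_le (by linarith)]
    linarith [Real.exp_one_lt_d9]
  have hαn := hα n (by omega)
  rw [Real.norm_of_nonneg (by positivity), Real.norm_of_nonneg hαn] at h1
  rw [Real.norm_of_nonneg (show (0 : ℝ) ≤ n by linarith)] at h2 ⊢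
  rw [Real.norm_of_nonneg (hr n)]
  -- The model allows `α n = 0`; the domination of `log n / n > 0` rules this out for large `n`,
  -- which permits dividing by `α n`.
  have hpos : 0 < α n := by
    have h3 : 0 < Real.log n / n := by positivity
    exact pos_of_mul_pos_right (h3.trans_le h1) hε.le
  have h3 : C ≤ α n * (c / 2 * n) := by
    have h4 : 1 ≤ c / 2 / (C + 1) * α n * n := by
      rw [div_le_iff₀ (by linarith)] at h1
      linarith
    rw [div_mul_eq_mul_div, div_mul_eq_mul_div, le_div_iff₀ (by linarith)] at h4
    nlinarith
  have h5 : α n * r n ≤ α n * (K * Real.log n + c / 2 * n) := by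
    rw [mul_add]
    linarith [h n (by omega)]
  have h6 := le_of_mul_le_mul_left h5 hpos
  have h7 := (le_abs_self _).trans h2
  linarith

end NestedUCB

theorem mainTheorem2 {Ω S : Type*} [MeasurableSpace Ω] [MeasurableSpace S]
    (P : Measure Ω) [IsProbabilityMeasure P]
    (α : ℕ → ℝ) (hα : NestedUCB.IsExogenous α)
    (μ : NestedUCB.ArmType → ℝ) (Δ : ℝ)
    (hΔ : Δ = μ NestedUCB.ArmType.optimal - μ NestedUCB.ArmType.inferior) (hΔ_pos : 0 < Δ)
    (E : NestedUCB.Env Ω S) (hE : NestedUCB.IsModel α μ P E)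
    (tie : NestedUCB.TieRule S)
    (htie : ∀ t, Measurable (fun p : (ℕ → ℝ × ℝ) × S => tie t p.1 p.2))
    :
    (∀ n, Integrable (NestedUCB.regret tie μ E n) P) ∧
    limsup (fun n : ℕ =>
        ((α n * (∫ ω, NestedUCB.regret tie μ E n ω ∂P) / Real.log n : ℝ) : EReal)) atTop
      ≤ ((8 / (Δ * NestedUCB.beta Δ) : ℝ) : EReal) ∧
    ((fun n : ℕ => Real.log n / n) =o[atTop] α →
      (fun n : ℕ => ∫ ω, NestedUCB.regret tie μ E n ω ∂P) =o[atTop] (fun n : ℕ => (n : ℝ))) := by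
  obtain ⟨C, hC, hle⟩ := hE.exists_regret_le htie hα hΔ hΔ_pos
  have hβ := NestedUCB.beta_pos Δ
  refine ⟨hE.integrable_regret htie, ?_, fun ho => ?_⟩
  · exact NestedUCB.limsup_le_of_forall_le_add (by positivity)
      (fun n hn => (hα.anti 1 n le_rfl hn).trans hα.one_lt_one.le) hle
  · exact NestedUCB.isLittleO_of_forall_le_add hC hα.nonneg
      (hE.integral_regret_nonneg htie (hΔ ▸ hΔ_pos)) hle ho
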